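/- Let $(M^{2n},S)$ be a tangent manifold: $M$ is a smooth manifold and $S$ is a smooth endomorphism field of $TM$ with $S^2=0$ and $\operatorname{im}S=\ker S$ which is integrable, i.e. around every point there are adapted coordinates $(x^i,y^i)$ with $S(\partial/\partial x^i)=\partial/\partial y^i$, $S(\partial/\partial y^i)=0$. Let $\mathcal V$ be the vertical foliation, $T\mathcal V=\operatorname{im}S$. A smooth function is foliated if its derivatives along $\mathcal V$ vanish; a vector field is foliated if it maps foliated functions to foliated functions; a smooth function $f$ is leafwise affine if $(SX)f$ is foliated for all local foliated vector fields $X$ (locally $f=\alpha_i(x)y^i+\beta(x)$); and a foliated $1$-form of type $(1,0)$ is locally of the form $\alpha_i(x)\,dx^i$. Let $\Phi\subseteq\underline A^0$ and $\underline\Omega^{(1,0)}_{pr}$ be the sheaves of germs of foliated functions, leafwise affine functions, and foliated $1$-forms of type $(1,0)$, let $\iota:\Phi\to\underline A^0$ be the inclusion and $\pi':\underline A^0\to\underline\Omega^{(1,0)}_{pr}$, $\pi'(\alpha_iy^i+\beta)=\alpha_i\,dx^i$. For a function $\mathcal L$ put $\theta_{\mathcal L}=d\mathcal L\circ S=(\partial\mathcal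 L/\partial y^i)dx^i$ and $\omega_{\mathcal L}=d\theta_{\mathcal L}$. Let $g$ be a non degenerate symmetric tensor field on the transversal bundle $TM/T\mathcal V$, and let $\{U_\alpha\}$ be an open covering of $M$ with smooth functions $\mathcal L_\alpha$ on $U_\alpha$ such that $g|_{U_\alpha}=\mathrm{Hess}\,\mathcal L_\alpha$ (locally $g_{ij}=\partial^2\mathcal L_\alpha/\partial y^i\partial y^j$) for all $\alpha$. Let $\mathcal G\in H^1(M,\underline A^0)$ be the class of the cocycle $\{\mathcal L_\beta-\mathcal L_\alpha\}$ and let $\mathcal G_1=\pi^*(\mathcal G)\in H^1(M,\underline\Omega^{(1,0)}_{pr})$ be the first Lagrangian obstruction, where $\iota^*,\pi^*$ are the maps induced by $\iota,\pi'$ in cohomology. A second Lagrangian obstruction is a class $\mathcal G_2\in H^1(M,\Phi)$ with $\iota^*(\mathcal G_2)=\mathcal G$; it is determined up to $\ker\iota^*$. A subordinated structure is a family of functions $\tilde{\mathcal L}_\mu$ on the members $V_\mu\subseteq U_{r(\mu)}$ of an open covering that refines $\{U_\alpha\}$, such that $g|_{V_\mu}=\mathrm{Hess}\,\tilde{\mathcal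 L}_\mu$ and $\tilde{\mathcal L}_\mu-\mathcal L_{r(\mu)}$ is leafwise affine on $V_\mu$. Then: 1. $\mathcal G_1=0$ if and only if there exists a subordinated structure $\{\tilde{\mathcal L}_\mu\}$ such that the $1$-forms $\theta_{\tilde{\mathcal L}_\mu}$ glue up to a global $1$-form. If every $U_\alpha$ is contained in the domain of adapted coordinates, the same equivalence holds with structures $\{\tilde{\mathcal L}_\alpha\}$ over the given covering $\{U_\alpha\}$. 2. If $\{\tilde{\mathcal L}_\mu\}$ is a subordinated structure such that the forms $\theta_{\tilde{\mathcal L}_\mu}$ glue up to a global $1$-form $\theta$, then $\{\tilde{\mathcal L}_\mu\}$ defines a locally Lagrangian-symplectic structure: $\Omega=d\theta$ is a symplectic form, $\Omega(X,SY)=\Omega(Y,SX)$ for all $X,Y$, and $\Omega|_{V_\mu}=\omega_{\tilde{\mathcal L}_\mu}$ for all $\mu$. 3. In the situation of 2, let $N\mathcal V$ be any smooth complement of $T\mathcal V$ in $TM$, and let $d''$ be the component of type $(0,1)$ of $d$ in the bigrading given by $TM=N\mathcal V\oplus T\mathcal V$. Then the local forms $d''\tilde{\mathcal L}_\mu$ glue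 up to a global $d''$-closed form $\kappa$ of type $(0,1)$, $\kappa$ represents exactly one class of $H^1(M,\Phi)$ (the class of the cocycle $\{f_j-f_i\}$, if $\kappa=d''f_i$ on the members of an open covering), and this class is a second Lagrangian obstruction $\mathcal G_2$. -/

import Mathlib

open scoped Manifold ContDiff Topology
open Set Bundle TopologicalSpace

universe u v w

noncomputable section

namespace LagrangeGeometry

/-! ### Čech cohomology in degree one -/

/-- A sheaf of abelian groups on `X` whose sections over an open set `U` are functions
`x ↦ s x ∈ V x` on `U`.  A section over `U` is encoded by a function on the whole of `X`, of which
only the restriction to `U` matters (`congr`); restriction to a smaller open set is then the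
identity on representatives (`mono`), and being a section is a local property (`locality`). -/
structure SectionSheaf (X : Type u) [TopologicalSpace X] (V : X → Type v)
    [∀ x, AddCommGroup (V x)] where
  /-- the functions that restrict to a section over `U` -/
  sec : Opens X → AddSubgroup (∀ x, V x)
  congr : ∀ {U : Opens X} {s t : ∀ x, V x}, (∀ x ∈ U, s x = t x) → s ∈ sec U → t ∈ sec U
  mono : ∀ {U W : Opens X}, U ≤ W → sec W ≤ sec U
  locality : ∀ {U : Opens X} {s : ∀ x, V x},
    (∀ x ∈ U, ∃ W : Opens X, x ∈ W ∧ s ∈ sec W) → s ∈ sec U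

namespace SectionSheaf

variable {X : Type u} [TopologicalSpace X] {V : X → Type v} [∀ x, AddCommGroup (V x)]
  {V' : X → Type w} [∀ x, AddCommGroup (V' x)]

/-- The Čech `1`-cocycles `c i j ∈ F(U i ∩ U j)`, `c i j + c j k = c i k`, of a family of open
sets. -/
def cocycles (F : SectionSheaf X V) {ι : Type*} (U : ι → Opens X) :
    AddSubgroup (ι → ι → ∀ x, V x) where
  carrier := {c | (∀ i j, c i j ∈ F.sec (U i ⊓ U j)) ∧
    ∀ i j k, ∀ x ∈ U i ⊓ U j ⊓ U k, c i j x + c j k x = c i k x}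
  zero_mem' := ⟨fun i j => (F.sec (U i ⊓ U j)).zero_mem, fun i j k x _ => by simp⟩
  add_mem' := by
    rintro a b ⟨ha, ha'⟩ ⟨hb, hb'⟩
    refine ⟨fun i j => (F.sec _).add_mem (ha i j) (hb i j), fun i j k x hx => ?_⟩
    simp only [Pi.add_apply]
    rw [← ha' i j k x hx, ← hb' i j k x hx]
    abel
  neg_mem' := by
    rintro a ⟨ha, ha'⟩
    refine ⟨fun i j => (F.sec _).neg_mem (ha i j), fun i j k x hx => ?_⟩
    simp only [Pi.neg_apply]
    rw [← ha' i j k x hx]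
    abel

/-- The Čech `1`-coboundaries: families which on `U i ∩ U j` are equal to `h j - h i` for
sections `h i ∈ F(U i)`.  (A family that vanishes on every `U i ∩ U j` is one of them, so that the
values of the representatives outside of `U i ∩ U j` play no role in the quotient below.) -/
def coboundaries (F : SectionSheaf X V) {ι : Type*} (U : ι → Opens X) :
    AddSubgroup (ι → ι → ∀ x, V x) where
  carrier := {c | ∃ h : ι → ∀ x, V x, (∀ i, h i ∈ F.sec (U i)) ∧
    ∀ i j, ∀ x ∈ U i ⊓ U j, c i j x = h j x - h i x}
  zero_mem' := ⟨0, fun i => (F.sec (U i)).zero_mem, fun i j x _ => by simp⟩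
  add_mem' := by
    rintro a b ⟨f, hf, hf'⟩ ⟨g, hg, hg'⟩
    refine ⟨f + g, fun i => (F.sec _).add_mem (hf i) (hg i), fun i j x hx => ?_⟩
    simp only [Pi.add_apply]
    rw [hf' i j x hx, hg' i j x hx]
    abel
  neg_mem' := by
    rintro a ⟨f, hf, hf'⟩
    refine ⟨-f, fun i => (F.sec _).neg_mem (hf i), fun i j x hx => ?_⟩
    simp only [Pi.neg_apply]
    rw [hf' i j x hx]
    abel

/-- The first Čech cohomology group of a family of open sets. -/
abbrev H1Cover (F : SectionSheaf X V) {ι : Type*} (U : ι → Opens X) : Type _ :=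
  (F.cocycles U) ⧸ (F.coboundaries U).addSubgroupOf (F.cocycles U)

instance (F : SectionSheaf X V) {ι : Type*} (U : ι → Opens X) : AddCommGroup (F.H1Cover U) :=
  QuotientAddGroup.Quotient.addCommGroup _

end SectionSheaf

/-- An open covering of `X` indexed by the points of `X`, with `x ∈ U x`.  Every open covering has
a refinement of this kind. -/
structure PointedCover (X : Type u) [TopologicalSpace X] where
  U : X → Opens X
  mem : ∀ x, x ∈ U x

namespace PointedCover

variable {X : Type u} [TopologicalSpace X]

/-- Finer coverings are larger. -/
instance : Preorder (PointedCover X) where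
  le A B := ∀ x, B.U x ≤ A.U x
  le_refl A x := le_rfl
  le_trans A B C hAB hBC x := (hBC x).trans (hAB x)

instance : DecidableEq (PointedCover X) := Classical.decEq _

/-- The covering obtained from an open covering by selecting for every point a member that
contains it. -/
def select {ι : Type*} (U : ι → Opens X) (hU : ∀ x, ∃ i, x ∈ U i) : PointedCover X where
  U x := U (hU x).choose
  mem x := (hU x).choose_spec

end PointedCover

namespace SectionSheaf

variable {X : Type u} [TopologicalSpace X] {V : X → Type v} [∀ x, AddCommGroup (V x)]
  {V' : X → Type w} [∀ x, AddCommGroup (V' x)]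

/-- Restriction of cocycles to a finer covering with the same index set. -/
def restrictCocycle (F : SectionSheaf X V) {ι : Type*} {U W : ι → Opens X} (h : ∀ i, W i ≤ U i) :
    F.cocycles U →+ F.cocycles W :=
  AddSubgroup.inclusion (fun _ hc =>
    ⟨fun i j => F.mono (inf_le_inf (h i) (h j)) (hc.1 i j),
      fun i j k x hx => hc.2 i j k x (inf_le_inf (inf_le_inf (h i) (h j)) (h k) hx)⟩)

/-- Restriction to a finer covering with the same index set, in cohomology. -/
def restrictH1 (F : SectionSheaf X V) {ι : Type*} {U W : ι → Opens X} (h : ∀ i, W i ≤ U i) :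
    F.H1Cover U →+ F.H1Cover W :=
  QuotientAddGroup.map _ _ (F.restrictCocycle h) (by
    rintro ⟨c, hc⟩ hb
    rw [AddSubgroup.mem_addSubgroupOf] at hb
    obtain ⟨f, hf, hf'⟩ := hb
    exact ⟨f, fun i => F.mono (h i) (hf i),
      fun i j x hx => hf' i j x (inf_le_inf (h i) (h j) hx)⟩)

/-- The first Čech cohomology group `H¹(X, F)`: the direct limit, over finer and finer open
coverings, of the groups of the coverings. -/
def H1 (F : SectionSheaf X V) : Type _ :=
  AddCommGroup.DirectLimit (fun A : PointedCover X => F.H1Cover A.U)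
    (fun _ _ h => F.restrictH1 h)

instance (F : SectionSheaf X V) : AddCommGroup F.H1 :=
  AddCommGroup.DirectLimit.addCommGroup _ _

/-- The cohomology class in `H¹(X, F)` of a cocycle on an arbitrary open covering. -/
def classOf (F : SectionSheaf X V) {ι : Type*} (U : ι → Opens X) (hU : ∀ x, ∃ i, x ∈ U i)
    (c : F.cocycles U) : F.H1 :=
  AddCommGroup.DirectLimit.of (fun A : PointedCover X => F.H1Cover A.U)
    (fun _ _ h => F.restrictH1 h) (PointedCover.select U hU)
    (QuotientAddGroup.mk ⟨fun x y => c.1 (hU x).choose (hU y).choose,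
      fun _ _ => c.2.1 _ _, fun _ _ _ => c.2.2 _ _ _⟩)

/-- A morphism of sheaves. -/
structure Hom (F : SectionSheaf X V) (G : SectionSheaf X V') where
  map : (∀ x, V x) → ∀ x, V' x
  map_mem : ∀ {U : Opens X} {s}, s ∈ F.sec U → map s ∈ G.sec U
  map_congr : ∀ {U : Opens X} {s t}, s ∈ F.sec U → t ∈ F.sec U → (∀ x ∈ U, s x = t x) →
    ∀ x ∈ U, map s x = map t x
  map_add : ∀ {U : Opens X} {s t}, s ∈ F.sec U → t ∈ F.sec U →
    ∀ x ∈ U, map (s + t) x = map s x + map t x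

namespace Hom

variable {F : SectionSheaf X V} {G : SectionSheaf X V'}

/-- If `a + b = c` on `U`, then the same holds after applying a morphism. -/
theorem map_add_eq (φ : Hom F G) {U : Opens X} {a b c : ∀ x, V x} (ha : a ∈ F.sec U)
    (hb : b ∈ F.sec U) (h : ∀ x ∈ U, a x + b x = c x) :
    ∀ x ∈ U, φ.map a x + φ.map b x = φ.map c x := by
  intro x hx
  have hab := (F.sec U).add_mem ha hb
  rw [← φ.map_add ha hb x hx]
  exact φ.map_congr hab (F.congr h hab) h x hx

/-- The map induced on the cohomology of a covering. -/
def mapCover (φ : Hom F G) {ι : Type*} (U : ι → Opens X) : F.H1Cover U →+ G.H1Cover U :=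
  QuotientAddGroup.lift _
    (AddMonoidHom.mk' (fun c : F.cocycles U =>
      (QuotientAddGroup.mk ⟨fun i j => φ.map (c.1 i j), fun i j => φ.map_mem (c.2.1 i j),
        fun i j k => φ.map_add_eq (F.mono inf_le_left (c.2.1 i j))
          (F.mono (le_inf (inf_le_left.trans inf_le_right) inf_le_right) (c.2.1 j k))
          (c.2.2 i j k)⟩ : G.H1Cover U))
      (by
        rintro ⟨a, ha⟩ ⟨b, hb⟩
        rw [← QuotientAddGroup.mk_add, QuotientAddGroup.eq]
        refine ⟨0, fun i => (G.sec _).zero_mem, fun i j x hx => ?_⟩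
        have := φ.map_add (ha.1 i j) (hb.1 i j) x hx
        simp [this]))
    (by
      rintro ⟨c, hc⟩ ⟨f, hf, hf'⟩
      refine (QuotientAddGroup.eq_zero_iff _).2 ⟨fun i => φ.map (f i), fun i => φ.map_mem (hf i),
        fun i j x hx => eq_sub_of_add_eq ?_⟩
      exact φ.map_add_eq (hc.1 i j) (F.mono inf_le_left (hf i))
        (fun y hy => by have := hf' i j y hy; simp at this; simp [this]) x hx)

/-- The map `H¹(X, F) → H¹(X, G)` induced by a morphism of sheaves. -/
def mapH1 (φ : Hom F G) : F.H1 →+ G.H1 :=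
  AddCommGroup.DirectLimit.map (fun A : PointedCover X => φ.mapCover A.U) (by
    intro A B h
    ext c
    rfl)

end Hom

end SectionSheaf

/-! ### Tangent manifolds -/

/-- The model space of a `2n`-dimensional manifold, with coordinates `(x, y)`. -/
abbrev Model (n : ℕ) : Type := (Fin n → ℝ) × (Fin n → ℝ)

section Manifold

variable {n : ℕ} {M : Type u} [TopologicalSpace M] [ChartedSpace (Model n) M]

variable (n) in
/-- A `1`-form on `M` (no regularity). -/
abbrev OneForm (M : Type u) [TopologicalSpace M] [ChartedSpace (Model n) M] : Type u :=
  ∀ x : M, TangentSpace 𝓘(ℝ, Model n) x →L[ℝ] ℝ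

variable (n) in
/-- A field of endomorphisms of the tangent spaces of `M` (no regularity). -/
abbrev EndField (M : Type u) [TopologicalSpace M] [ChartedSpace (Model n) M] : Type u :=
  ∀ x : M, TangentSpace 𝓘(ℝ, Model n) x →L[ℝ] TangentSpace 𝓘(ℝ, Model n) x

variable (n) in
/-- A vector field on `M` (no regularity). -/
abbrev VField (M : Type u) [TopologicalSpace M] [ChartedSpace (Model n) M] : Type u :=
  ∀ x : M, TangentSpace 𝓘(ℝ, Model n) x

variable (n) in
/-- A real function is smooth on `U`. -/
abbrev SmoothFun (f : M → ℝ) (U : Set M) : Prop :=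
  ContMDiffOn 𝓘(ℝ, Model n) 𝓘(ℝ, ℝ) ∞ f U

variable (n) in
/-- The differential of a real function. -/
abbrev diff (f : M → ℝ) : OneForm n M := fun x => mvfderiv 𝓘(ℝ, Model n) f x

variable [IsManifold 𝓘(ℝ, Model n) ∞ M]

/-- A `1`-form is smooth on `U`. -/
def SmoothForm (η : OneForm n M) (U : Set M) : Prop :=
  ContMDiffOn 𝓘(ℝ, Model n) (𝓘(ℝ, Model n).prod 𝓘(ℝ, Model n →L[ℝ] ℝ)) ∞
    (fun x => TotalSpace.mk' (Model n →L[ℝ] ℝ)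
      (E := fun x : M => TangentSpace 𝓘(ℝ, Model n) x →L[ℝ] ℝ) x (η x)) U

/-- A field of endomorphisms is smooth. -/
def SmoothEnd (A : EndField n M) : Prop :=
  ContMDiff 𝓘(ℝ, Model n) (𝓘(ℝ, Model n).prod 𝓘(ℝ, Model n →L[ℝ] Model n)) ∞
    (fun x => TotalSpace.mk' (Model n →L[ℝ] Model n)
      (E := fun x : M => TangentSpace 𝓘(ℝ, Model n) x →L[ℝ] TangentSpace 𝓘(ℝ, Model n) x) x (A x))

/-- A vector field is smooth on `U`. -/
def SmoothField (X : VField n M) (U : Set M) : Prop :=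
  ContMDiffOn 𝓘(ℝ, Model n) 𝓘(ℝ, Model n).tangent ∞
    (fun x => (⟨x, X x⟩ : TangentBundle 𝓘(ℝ, Model n) M)) U

/-- A chart `(x¹, …, xⁿ, y¹, …, yⁿ)` of the smooth structure of `M` in which
`S (∂/∂xⁱ) = ∂/∂yⁱ` and `S (∂/∂yⁱ) = 0`. -/
def IsAdaptedChart (S : EndField n M) (φ : OpenPartialHomeomorph M (Model n)) : Prop :=
  φ ∈ IsManifold.maximalAtlas 𝓘(ℝ, Model n) ∞ M ∧
    ∀ x ∈ φ.source, ∀ v : TangentSpace 𝓘(ℝ, Model n) x,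
      mfderiv 𝓘(ℝ, Model n) 𝓘(ℝ, Model n) φ x (S x v) =
        ((0, (mfderiv 𝓘(ℝ, Model n) 𝓘(ℝ, Model n) φ x v : Model n).1) : Model n)

variable (n M) in
/-- A tangent structure on `M`: an endomorphism field `S` with `im S = ker S` (hence `S² = 0`)
that is integrable, i.e. there are adapted charts around all the points. -/
structure TangentStructure where
  S : EndField n M
  smooth : SmoothEnd S
  range_eq_ker : ∀ x, (S x).range = (S x).ker
  integrable : ∀ x, ∃ φ, IsAdaptedChart S φ ∧ x ∈ φ.source

namespace TangentStructure

variable (T : TangentStructure n M)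

theorem S_S (x : M) (v : TangentSpace 𝓘(ℝ, Model n) x) : T.S x (T.S x v) = 0 := by
  have : T.S x v ∈ (T.S x).range := ⟨v, rfl⟩
  rw [T.range_eq_ker x] at this
  exact this

/-- `f` is a foliated function on `U`: it is smooth, and its derivatives in the directions of the
vertical foliation (the tangent distribution of which is `im S`) vanish. -/
def FoliatedFun (f : M → ℝ) (U : Opens M) : Prop :=
  SmoothFun n f U ∧ ∀ x ∈ U, ∀ v, diff n f x (T.S x v) = 0

/-- `X` is a foliated vector field on `U`: it is smooth, and it projects to the local spaces of
leaves, i.e. it sends foliated functions to foliated functions. -/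
def FoliatedField (X : VField n M) (U : Opens M) : Prop :=
  SmoothField X U ∧ ∀ (W : Opens M) (f : M → ℝ), W ≤ U → T.FoliatedFun f W →
    T.FoliatedFun (fun x => diff n f x (X x)) W

/-- `f` is a leafwise affine function on `U`: it is smooth, and `Y f` is foliated for all the local
parallel vector fields along the leaves, i.e. for `Y = S X` with `X` foliated. -/
def LeafwiseAffine (f : M → ℝ) (U : Opens M) : Prop :=
  SmoothFun n f U ∧ ∀ (W : Opens M) (X : VField n M), W ≤ U → T.FoliatedField X W →
    T.FoliatedFun (fun x => diff n f x (T.S x (X x))) W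

/-- `η` is a foliated `1`-form of type `(1,0)` on `U`: it is smooth, it vanishes on the vectors
tangent to the leaves, and its values on foliated vector fields are foliated functions; locally,
`η = ∑ ηᵢ(x) dxⁱ`. -/
def FoliatedForm (η : OneForm n M) (U : Opens M) : Prop :=
  SmoothForm η U ∧ (∀ x ∈ U, ∀ v, η x (T.S x v) = 0) ∧
    ∀ (W : Opens M) (X : VField n M), W ≤ U → T.FoliatedField X W →
      T.FoliatedFun (fun x => η x (X x)) W

/-- The `1`-form `θ_L = dL ∘ S` of a Lagrangian; in an adapted chart, `∑ (∂L/∂yⁱ) dxⁱ`. -/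
def theta (L : M → ℝ) : OneForm n M := fun x => (diff n L x).comp (T.S x)

/-- `g` is the Hessian of `L` on `U`: `g(X, Y) = (SY)(SX)L` for all the local foliated vector fields
`X`, `Y`; in an adapted chart, `gᵢⱼ = ∂²L/∂yⁱ∂yʲ`. -/
def IsHessian (L : M → ℝ) (U : Opens M)
    (g : ∀ x : M, TangentSpace 𝓘(ℝ, Model n) x →L[ℝ] TangentSpace 𝓘(ℝ, Model n) x →L[ℝ] ℝ) :
    Prop :=
  ∀ (W : Opens M) (X Y : VField n M), W ≤ U → T.FoliatedField X W → T.FoliatedField Y W →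
    ∀ x ∈ W, g x (X x) (Y x) = diff n (fun z => diff n L z (T.S z (X z))) x (T.S x (Y x))

end TangentStructure

set_option linter.unusedSectionVars false

/-! ### Facts used to set up the sheaves -/

theorem diff_congr {f g : M → ℝ} {U : Opens M} (h : ∀ x ∈ U, f x = g x) {x : M} (hx : x ∈ U) :
    diff n f x = diff n g x := by
  have : f =ᶠ[𝓝 x] g := Filter.eventually_of_mem (U.isOpen.mem_nhds hx) h
  ext v
  change mfderiv 𝓘(ℝ, Model n) 𝓘(ℝ, ℝ) f x v = mfderiv 𝓘(ℝ, Model n) 𝓘(ℝ, ℝ) g x v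
  rw [this.mfderiv_eq]
  rfl

theorem diff_add {f g : M → ℝ} {U : Opens M} (hf : SmoothFun n f U) (hg : SmoothFun n g U)
    {x : M} (hx : x ∈ U) : diff n (f + g) x = diff n f x + diff n g x :=
  mvfderiv_add ((hf.contMDiffAt (U.isOpen.mem_nhds hx)).mdifferentiableAt (by simp))
    ((hg.contMDiffAt (U.isOpen.mem_nhds hx)).mdifferentiableAt (by simp))

theorem diff_neg (f : M → ℝ) (x : M) : diff n (-f) x = - diff n f x := mvfderiv_neg

theorem diff_sub {f g : M → ℝ} {U : Opens M} (hf : SmoothFun n f U) (hg : SmoothFun n g U)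
    {x : M} (hx : x ∈ U) : diff n (f - g) x = diff n f x - diff n g x :=
  mvfderiv_sub ((hf.contMDiffAt (U.isOpen.mem_nhds hx)).mdifferentiableAt (by simp))
    ((hg.contMDiffAt (U.isOpen.mem_nhds hx)).mdifferentiableAt (by simp))

theorem diff_zero (x : M) : diff n (0 : M → ℝ) x = 0 := mvfderiv_const 0

theorem diff_smoothOn {f : M → ℝ} {U : Opens M} (hf : SmoothFun n f U) :
    SmoothForm (diff n f) (U : Set M) := by
  intro x hx
  apply ContMDiffAt.contMDiffWithinAt
  have hfx := hf.contMDiffAt (U.isOpen.mem_nhds hx)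
  have h := hfx.mfderiv_const (m := ∞) (by simp)
  rw [contMDiffAt_hom_bundle]
  refine ⟨contMDiffAt_id, h.congr_of_eventuallyEq (Filter.Eventually.of_forall fun y => ?_)⟩
  refine ContinuousLinearMap.ext fun v => ?_
  simp only [inTangentCoordinates, ContinuousLinearMap.inCoordinates]
  simp
  rfl

theorem smoothForm_comp {η : OneForm n M} {A : EndField n M} {U : Set M} (hη : SmoothForm η U)
    (hA : SmoothEnd A) : SmoothForm (fun x => (η x).comp (A x)) U := by
  intro x hx
  have h1 := (contMDiffWithinAt_hom_bundle _).1 (hη x hx)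
  have h2 := (contMDiffWithinAt_hom_bundle _).1 ((hA x).contMDiffWithinAt (s := U))
  refine (contMDiffWithinAt_hom_bundle _).2 ⟨contMDiffWithinAt_id, ?_⟩
  have key : ∀ y ∈ (trivializationAt (Model n) (TangentSpace 𝓘(ℝ, Model n)) x).baseSet,
      ContinuousLinearMap.inCoordinates (Model n) (TangentSpace 𝓘(ℝ, Model n)) ℝ
          (Bundle.Trivial M ℝ) x y x y ((η y).comp (A y)) =
        (ContinuousLinearMap.inCoordinates (Model n) (TangentSpace 𝓘(ℝ, Model n)) ℝ
          (Bundle.Trivial M ℝ) x y x y (η y)).comp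
        (ContinuousLinearMap.inCoordinates (Model n) (TangentSpace 𝓘(ℝ, Model n)) (Model n)
          (TangentSpace 𝓘(ℝ, Model n)) x y x y (A y)) := by
    intro y hy
    refine ContinuousLinearMap.ext fun v => ?_
    simp only [ContinuousLinearMap.inCoordinates, ContinuousLinearMap.comp_apply]
    rw [Trivialization.symmL_continuousLinearMapAt _ hy]
  refine (h1.2.clm_comp h2.2).congr_of_eventuallyEq ?_
    (key x (FiberBundle.mem_baseSet_trivializationAt' x))
  exact Filter.eventually_of_mem (mem_nhdsWithin_of_mem_nhds
    ((trivializationAt (Model n) (TangentSpace 𝓘(ℝ, Model n)) x).open_baseSet.mem_nhds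
      (FiberBundle.mem_baseSet_trivializationAt' x))) key

theorem smoothFun_apply {η : OneForm n M} {X : VField n M} {U : Set M} (hη : SmoothForm η U)
    (hX : SmoothField X U) : SmoothFun n (fun x => η x (X x)) U := by
  have := ContMDiffOn.clm_bundle_apply (F₁ := Model n) (F₂ := ℝ) (E₂ := Bundle.Trivial M ℝ) hη hX
  intro x hx
  exact ((contMDiffWithinAt_totalSpace).1 (this x hx)).2

theorem diff_comp_chart {φ : OpenPartialHomeomorph M (Model n)}
    (hφ : φ ∈ IsManifold.maximalAtlas 𝓘(ℝ, Model n) ∞ M) {h : Model n → ℝ} {x : M}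
    (hx : x ∈ φ.source) (hh : DifferentiableAt ℝ h (φ x)) (v : TangentSpace 𝓘(ℝ, Model n) x) :
    diff n (h ∘ φ) x v = fderiv ℝ h (φ x) (mfderiv 𝓘(ℝ, Model n) 𝓘(ℝ, Model n) φ x v) := by
  have h1 : MDifferentiableAt 𝓘(ℝ, Model n) 𝓘(ℝ, Model n) φ x :=
    (contMDiffAt_of_mem_maximalAtlas hφ hx).mdifferentiableAt (by simp)
  change mfderiv 𝓘(ℝ, Model n) 𝓘(ℝ, ℝ) (h ∘ φ) x v = _
  rw [mfderiv_comp x hh.mdifferentiableAt h1, mfderiv_eq_fderiv]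
  rfl

/-- Every tangent vector is the value of a local foliated vector field, namely of one with constant
components in an adapted chart. -/
theorem TangentStructure.exists_foliatedField (T : TangentStructure n M) (x : M)
    (v : TangentSpace 𝓘(ℝ, Model n) x) :
    ∃ (W : Opens M) (X : VField n M), x ∈ W ∧ T.FoliatedField X W ∧ X x = v := by
  obtain ⟨φ, ⟨hφ, hS⟩, hx⟩ := T.integrable x
  have hsymm := contMDiffOn_symm_of_mem_maximalAtlas hφ
  have hfwd := contMDiffOn_of_mem_maximalAtlas hφ
  set c : Model n := mfderiv 𝓘(ℝ, Model n) 𝓘(ℝ, Model n) φ x v with hc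
  have hmd : φ.MDifferentiable 𝓘(ℝ, Model n) 𝓘(ℝ, Model n) :=
    ⟨hfwd.mdifferentiableOn (by simp), hsymm.mdifferentiableOn (by simp)⟩
  have hinv : ∀ y ∈ φ.source,
      (mfderiv 𝓘(ℝ, Model n) 𝓘(ℝ, Model n) φ y).IsInvertible := fun y hy => ⟨hmd.mfderiv hy, rfl⟩
  let X : VField n M := VectorField.mpullback 𝓘(ℝ, Model n) 𝓘(ℝ, Model n) φ (fun _ => c)
  have hX : ∀ y ∈ φ.source, mfderiv 𝓘(ℝ, Model n) 𝓘(ℝ, Model n) φ y (X y) = c := fun y hy =>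
    (hinv y hy).self_apply_inverse c
  have hXs : SmoothField X φ.source := by
    intro y hy
    refine (ContMDiffAt.mpullback_vectorField_preimage (n := ∞) ?_
      (contMDiffAt_of_mem_maximalAtlas hφ hy) (hinv y hy) (by simp)).contMDiffWithinAt
    exact contMDiffAt_vectorSpace_iff_contDiffAt.2 contDiffAt_const
  refine ⟨⟨φ.source, φ.open_source⟩, X, hx, ⟨hXs, ?_⟩, ?_⟩
  · intro W f hW hf
    have hsm := smoothFun_apply (diff_smoothOn hf.1) (hXs.mono hW)
    refine ⟨hsm, fun y hy w => ?_⟩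
    set F : Model n → ℝ := f ∘ φ.symm with hF
    have hFs : ∀ z ∈ W, ContDiffAt ℝ ∞ F (φ z) := by
      intro z hz
      have hz' : z ∈ φ.source := hW hz
      have h1 : ContMDiffAt 𝓘(ℝ, Model n) 𝓘(ℝ, ℝ) ∞ f (φ.symm (φ z)) := by
        rw [φ.left_inv hz']
        exact hf.1.contMDiffAt (W.isOpen.mem_nhds hz)
      exact (h1.comp (φ z) (contMDiffAt_symm_of_mem_maximalAtlas hφ
        (φ.map_source hz'))).contDiffAt
    have hdf : ∀ z ∈ W, ∀ u : TangentSpace 𝓘(ℝ, Model n) z, diff n f z u =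
        fderiv ℝ F (φ z) (mfderiv 𝓘(ℝ, Model n) 𝓘(ℝ, Model n) φ z u) := by
      intro z hz u
      rw [← diff_comp_chart hφ (hW hz) ((hFs z hz).differentiableAt (by simp)) u]
      rw [diff_congr (U := W) (g := F ∘ φ) (fun z' hz' => ?_) hz]
      simp [hF, φ.left_inv (hW hz')]
    have hvert : ∀ z ∈ W, ∀ b : Fin n → ℝ, fderiv ℝ F (φ z) ((0, b) : Model n) = 0 := by
      intro z hz b
      obtain ⟨u, hu⟩ := (hmd.mfderiv (hW hz)).surjective ((b, 0) : Model n)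
      have hu' : mfderiv 𝓘(ℝ, Model n) 𝓘(ℝ, Model n) φ z u = ((b, 0) : Model n) := hu
      have h2 := hf.2 z hz u
      rw [hdf z hz, hS z (hW hz) u, hu'] at h2
      exact h2
    have h2 : ContDiffAt ℝ ∞ (fderiv ℝ F) (φ y) := (hFs y hy).fderiv_right (by simp)
    have h2d : DifferentiableAt ℝ (fderiv ℝ F) (φ y) := h2.differentiableAt (by simp)
    have hD : diff n (fun z => diff n f z (X z)) y =
        diff n ((fun p => fderiv ℝ F p c) ∘ φ) y := by
      refine diff_congr (U := W) (fun z hz => ?_) hy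
      rw [hdf z hz, hX z (hW hz)]
      rfl
    rw [hD, diff_comp_chart hφ (hW hy) (h2d.clm_apply (differentiableAt_const c)),
      hS y (hW hy) w]
    set b : Fin n → ℝ := (mfderiv 𝓘(ℝ, Model n) 𝓘(ℝ, Model n) φ y w : Model n).1
    have hcomm : fderiv ℝ (fun p => fderiv ℝ F p c) (φ y) ((0, b) : Model n) =
        fderiv ℝ (fun p => fderiv ℝ F p ((0, b) : Model n)) (φ y) c := by
      rw [fderiv_clm_apply h2d (differentiableAt_const c),
        fderiv_clm_apply h2d (differentiableAt_const _)]
      simpa using ((hFs y hy).isSymmSndFDerivAt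
        (by rw [minSmoothness_of_isRCLikeNormedField]; exact ENat.LEInfty.out)) ((0, b) : Model n) c
    rw [hcomm]
    have hzero : (fun p => fderiv ℝ F p ((0, b) : Model n)) =ᶠ[𝓝 (φ y)] fun _ => (0 : ℝ) := by
      have hnhds : φ.symm ⁻¹' W ∩ φ.target ∈ 𝓝 (φ y) := by
        refine Filter.inter_mem ?_ (φ.open_target.mem_nhds (φ.map_source (hW hy)))
        refine (φ.continuousAt_symm (φ.map_source (hW hy))).preimage_mem_nhds ?_
        rw [φ.left_inv (hW hy)]
        exact W.isOpen.mem_nhds hy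
      filter_upwards [hnhds] with p hp
      have := hvert (φ.symm p) hp.1 b
      rwa [φ.right_inv hp.2] at this
    rw [hzero.fderiv_eq]
    simp
  · exact (hmd.mfderiv hx).injective (hX x hx)

namespace TangentStructure

variable {T : TangentStructure n M} {U W : Opens M}

theorem FoliatedFun.congr {f g : M → ℝ} (h : ∀ x ∈ U, f x = g x) (hf : T.FoliatedFun f U) :
    T.FoliatedFun g U :=
  ⟨hf.1.congr fun x hx => (h x hx).symm, fun x hx v => by rw [← diff_congr h hx]; exact hf.2 x hx v⟩

theorem FoliatedFun.mono {f : M → ℝ} (h : U ≤ W) (hf : T.FoliatedFun f W) : T.FoliatedFun f U :=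
  ⟨ContMDiffOn.mono hf.1 h, fun x hx v => hf.2 x (h hx) v⟩

theorem FoliatedFun.of_local {f : M → ℝ}
    (h : ∀ x ∈ U, ∃ W : Opens M, x ∈ W ∧ T.FoliatedFun f W) : T.FoliatedFun f U := by
  refine ⟨fun x hx => ?_, fun x hx v => ?_⟩ <;> obtain ⟨W, hxW, hW⟩ := h x hx
  · exact (hW.1.contMDiffAt (W.isOpen.mem_nhds hxW)).contMDiffWithinAt
  · exact hW.2 x hxW v

theorem FoliatedFun.zero : T.FoliatedFun (0 : M → ℝ) U :=
  ⟨contMDiffOn_const, fun x _ v => by rw [diff_zero]; rfl⟩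

theorem FoliatedFun.add {f g : M → ℝ} (hf : T.FoliatedFun f U) (hg : T.FoliatedFun g U) :
    T.FoliatedFun (f + g) U :=
  ⟨ContMDiffOn.add hf.1 hg.1, fun x hx v => by
    rw [diff_add hf.1 hg.1 hx, add_apply, hf.2 x hx v, hg.2 x hx v, add_zero]⟩

theorem FoliatedFun.neg {f : M → ℝ} (hf : T.FoliatedFun f U) : T.FoliatedFun (-f) U :=
  ⟨ContMDiffOn.neg hf.1, fun x hx v => by
    rw [diff_neg, neg_apply, hf.2 x hx v, neg_zero]⟩

theorem FoliatedField.mono {X : VField n M} (h : U ≤ W) (hX : T.FoliatedField X W) :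
    T.FoliatedField X U :=
  ⟨ContMDiffOn.mono hX.1 h, fun W' f hW' hf => hX.2 W' f (hW'.trans h) hf⟩

theorem smoothForm_theta {f : M → ℝ} (hf : SmoothFun n f U) :
    SmoothForm (T.theta f) (U : Set M) :=
  smoothForm_comp (diff_smoothOn hf) T.smooth

theorem FoliatedFun.leafwiseAffine {f : M → ℝ} (hf : T.FoliatedFun f U) : T.LeafwiseAffine f U :=
  ⟨hf.1, fun _ _ hW _ => FoliatedFun.zero.congr fun x hx => (hf.2 x (hW hx) _).symm⟩

theorem LeafwiseAffine.foliatedForm_theta {f : M → ℝ} (hf : T.LeafwiseAffine f U) :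
    T.FoliatedForm (T.theta f) U :=
  ⟨smoothForm_theta hf.1, fun x _ v => by
    change diff n f x (T.S x (T.S x v)) = 0
    rw [T.S_S, map_zero], hf.2⟩

variable (T)

/-- The sheaf `Φ` of germs of foliated functions. -/
def foliatedFunctions : SectionSheaf M (fun _ => ℝ) where
  sec U :=
    { carrier := {f | T.FoliatedFun f U}
      zero_mem' := FoliatedFun.zero
      add_mem' := FoliatedFun.add
      neg_mem' := FoliatedFun.neg }
  congr := FoliatedFun.congr
  mono h _ hf := FoliatedFun.mono h hf
  locality := FoliatedFun.of_local

/-- The sheaf `A⁰` of germs of leafwise affine functions. -/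
def leafwiseAffineFunctions : SectionSheaf M (fun _ => ℝ) where
  sec U :=
    { carrier := {f | T.LeafwiseAffine f U}
      zero_mem' := FoliatedFun.zero.leafwiseAffine
      add_mem' := fun {f g} hf hg => ⟨ContMDiffOn.add hf.1 hg.1, fun W X hW hX =>
        ((hf.2 W X hW hX).add (hg.2 W X hW hX)).congr fun x hx => by
          rw [diff_add hf.1 hg.1 (hW hx)]
          rfl⟩
      neg_mem' := fun {f} hf => ⟨ContMDiffOn.neg hf.1, fun W X hW hX =>
        (hf.2 W X hW hX).neg.congr fun x hx => by
          rw [diff_neg]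
          rfl⟩ }
  congr := fun h hf => ⟨hf.1.congr fun x hx => (h x hx).symm, fun W X hW hX =>
    (hf.2 W X hW hX).congr fun x hx => by rw [diff_congr h (hW hx)]⟩
  mono := fun h _ hf => ⟨ContMDiffOn.mono hf.1 h, fun W X hW hX => hf.2 W X (hW.trans h) hX⟩
  locality := fun {U f} h => by
    refine ⟨fun x hx => ?_, fun W X hW hX => FoliatedFun.of_local fun x hx => ?_⟩
    · obtain ⟨W, hxW, hW⟩ := h x hx
      exact (hW.1.contMDiffAt (W.isOpen.mem_nhds hxW)).contMDiffWithinAt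
    · obtain ⟨W', hxW', hW'⟩ := h x (hW hx)
      exact ⟨W ⊓ W', ⟨hx, hxW'⟩, hW'.2 _ X inf_le_right (hX.mono inf_le_left)⟩

/-- The sheaf `Ω_pr^(1,0)` of germs of foliated `1`-forms of type `(1,0)`. -/
def foliatedForms : SectionSheaf M (fun x => TangentSpace 𝓘(ℝ, Model n) x →L[ℝ] ℝ) where
  sec U :=
    { carrier := {η | T.FoliatedForm η U}
      zero_mem' := by
        refine ⟨?_, fun x _ v => rfl, fun W X _ _ => FoliatedFun.zero⟩
        have h : SmoothForm (diff n (0 : M → ℝ)) (U : Set M) := diff_smoothOn contMDiffOn_const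
        exact h.congr fun x _ => by rw [diff_zero]; rfl
      add_mem' := fun {a b} ha hb => ⟨ContMDiffOn.add_section ha.1 hb.1, fun x hx v => by
        rw [Pi.add_apply, add_apply, ha.2.1 x hx v, hb.2.1 x hx v, add_zero],
        fun W X hW hX => (ha.2.2 W X hW hX).add (hb.2.2 W X hW hX)⟩
      neg_mem' := fun {a} ha => ⟨ContMDiffOn.neg_section ha.1, fun x hx v => by
        rw [Pi.neg_apply, neg_apply, ha.2.1 x hx v, neg_zero],
        fun W X hW hX => (ha.2.2 W X hW hX).neg⟩ }
  congr := fun {U a b} h ha => ⟨ha.1.congr fun x hx => by rw [h x hx],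
    fun x hx v => by rw [← h x hx]; exact ha.2.1 x hx v,
    fun W X hW hX => (ha.2.2 W X hW hX).congr fun x hx => by rw [h x (hW hx)]⟩
  mono := fun h _ ha => ⟨ContMDiffOn.mono ha.1 h, fun x hx v => ha.2.1 x (h hx) v,
    fun W X hW hX => ha.2.2 W X (hW.trans h) hX⟩
  locality := fun {U a} h => by
    refine ⟨fun x hx => ?_, fun x hx v => ?_, fun W X hW hX => FoliatedFun.of_local fun x hx => ?_⟩
    · obtain ⟨W, hxW, hW⟩ := h x hx
      exact (ContMDiffOn.contMDiffAt hW.1 (W.isOpen.mem_nhds hxW)).contMDiffWithinAt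
    · obtain ⟨W, hxW, hW⟩ := h x hx
      exact hW.2.1 x hxW v
    · obtain ⟨W', hxW', hW'⟩ := h x (hW hx)
      exact ⟨W ⊓ W', ⟨hx, hxW'⟩, hW'.2.2 _ X inf_le_right (hX.mono inf_le_left)⟩

/-- The inclusion `ι : Φ → A⁰`. -/
def iota : SectionSheaf.Hom T.foliatedFunctions T.leafwiseAffineFunctions where
  map f := f
  map_mem := fun {_ _} h => FoliatedFun.leafwiseAffine h
  map_congr _ _ h := h
  map_add _ _ _ _ := rfl

/-- The morphism `π' : A⁰ → Ω_pr^(1,0)`, in an adapted chart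
`∑ αᵢ(x) yⁱ + β(x) ↦ ∑ αᵢ(x) dxⁱ`. -/
def piPrime : SectionSheaf.Hom T.leafwiseAffineFunctions T.foliatedForms where
  map f := T.theta f
  map_mem := fun {_ _} h => LeafwiseAffine.foliatedForm_theta h
  map_congr := fun {_ _ _} _ _ h x hx => by
    change (diff n _ x).comp (T.S x) = (diff n _ x).comp (T.S x)
    rw [diff_congr h hx]
  map_add := fun {_ f g} hf hg x hx => by
    change (diff n (f + g) x).comp (T.S x) =
      (diff n f x).comp (T.S x) + (diff n g x).comp (T.S x)
    rw [diff_add hf.1 hg.1 hx, ContinuousLinearMap.add_comp]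

end TangentStructure

/-! ### Locally Lagrange spaces -/

/-- A non degenerate symmetric tensor field on the transversal bundle of the vertical foliation,
seen as a symmetric `2`-covariant tensor field on `M` annihilated by `im S`. -/
structure TransversalMetric (T : TangentStructure n M) where
  g : ∀ x : M, TangentSpace 𝓘(ℝ, Model n) x →L[ℝ] TangentSpace 𝓘(ℝ, Model n) x →L[ℝ] ℝ
  smooth : ContMDiff 𝓘(ℝ, Model n)
    (𝓘(ℝ, Model n).prod 𝓘(ℝ, Model n →L[ℝ] Model n →L[ℝ] ℝ)) ∞
    (fun x => TotalSpace.mk' (Model n →L[ℝ] Model n →L[ℝ] ℝ)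
      (E := fun x : M =>
        TangentSpace 𝓘(ℝ, Model n) x →L[ℝ] TangentSpace 𝓘(ℝ, Model n) x →L[ℝ] ℝ) x (g x))
  symm : ∀ x v w, g x v w = g x w v
  vertical : ∀ x v w, g x (T.S x v) w = 0
  nondegenerate : ∀ x v, (∀ w, g x v w = 0) → v ∈ (T.S x).range

/-- Local Lagrangians `L i` on the members `U i` of an open covering of `M` that make `(M, S, g)` a
locally Lagrange space: `g` is the Hessian of `L i` on `U i`.  (The `L i` are regular, since `g` is
non degenerate.) -/
structure LocalLagrangians (T : TangentStructure n M) (g : TransversalMetric T) {ι : Type*}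
    (U : ι → Opens M) where
  L : ι → M → ℝ
  cover : ∀ x, ∃ i, x ∈ U i
  smooth : ∀ i, SmoothFun n (L i) (U i)
  hessian : ∀ i, T.IsHessian (L i) (U i) g.g

namespace LocalLagrangians

variable {T : TangentStructure n M} {g : TransversalMetric T} {ι : Type*} {U : ι → Opens M}

/-- On overlaps, the local Lagrangians differ by leafwise affine functions. -/
theorem leafwiseAffine_sub (𝓛 : LocalLagrangians T g U) (i j : ι) :
    T.LeafwiseAffine (𝓛.L j - 𝓛.L i) (U i ⊓ U j) := by
  have hi : SmoothFun n (𝓛.L i) (U i ⊓ U j : Opens M) := (𝓛.smooth i).mono inf_le_left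
  have hj : SmoothFun n (𝓛.L j) (U i ⊓ U j : Opens M) := (𝓛.smooth j).mono inf_le_right
  refine ⟨ContMDiffOn.sub hj hi, fun W X hW hX => ?_⟩
  have hWi : W ≤ U i := hW.trans inf_le_left
  have hWj : W ≤ U j := hW.trans inf_le_right
  have hs : ∀ k, W ≤ U k → SmoothFun n (fun z => diff n (𝓛.L k) z (T.S z (X z))) W :=
    fun k hk => smoothFun_apply (η := T.theta (𝓛.L k))
      (TangentStructure.smoothForm_theta ((𝓛.smooth k).mono hk)) hX.1
  have heq : ∀ x ∈ W, ((fun z => diff n (𝓛.L j) z (T.S z (X z))) -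
      (fun z => diff n (𝓛.L i) z (T.S z (X z)))) x =
      diff n (𝓛.L j - 𝓛.L i) x (T.S x (X x)) := by
    intro x hx
    rw [diff_sub hj hi (hW hx)]
    rfl
  refine TangentStructure.FoliatedFun.congr heq
    ⟨ContMDiffOn.sub (hs j hWj) (hs i hWi), fun x hx v => ?_⟩
  obtain ⟨W', Y, hxW', hY, rfl⟩ := T.exists_foliatedField x v
  have hi' := 𝓛.hessian i (W ⊓ W') X Y (inf_le_left.trans hWi) (hX.mono inf_le_left)
    (hY.mono inf_le_right) x ⟨hx, hxW'⟩
  have hj' := 𝓛.hessian j (W ⊓ W') X Y (inf_le_left.trans hWj) (hX.mono inf_le_left)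
    (hY.mono inf_le_right) x ⟨hx, hxW'⟩
  rw [diff_sub (hs j hWj) (hs i hWi) hx, sub_apply, ← hi', ← hj', sub_self]

/-- The cocycle `L j - L i` with values in `A⁰`. -/
def cocycle (𝓛 : LocalLagrangians T g U) : T.leafwiseAffineFunctions.cocycles U :=
  ⟨fun i j => 𝓛.L j - 𝓛.L i, fun i j => 𝓛.leafwiseAffine_sub i j,
    fun i j k x _ => by simp only [Pi.sub_apply]; ring⟩

/-- The total Lagrangian obstruction `𝒢 ∈ H¹(M, A⁰)`. -/
def totalObstruction (𝓛 : LocalLagrangians T g U) : T.leafwiseAffineFunctions.H1 :=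
  T.leafwiseAffineFunctions.classOf U 𝓛.cover 𝓛.cocycle

/-- The first Lagrangian obstruction `𝒢₁ = π*(𝒢) ∈ H¹(M, Ω_pr^(1,0))`. -/
def firstObstruction (𝓛 : LocalLagrangians T g U) : T.foliatedForms.H1 :=
  T.piPrime.mapH1 𝓛.totalObstruction

/-- `c ∈ H¹(M, Φ)` is a second Lagrangian obstruction: `ι*(c) = 𝒢`.  (This determines `c` up to the
kernel of `ι*`.) -/
def IsSecondObstruction (𝓛 : LocalLagrangians T g U) (c : T.foliatedFunctions.H1) : Prop :=
  T.iota.mapH1 c = 𝓛.totalObstruction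

/-- `𝓛'` is subordinated to `𝓛` by `r`: the covering of `𝓛'` refines the covering of `𝓛` by `r`,
and the local Lagrangians of `𝓛'` are obtained from those of `𝓛` by the addition of leafwise affine
functions. -/
def Subordinated {κ : Type*} {V : κ → Opens M} (𝓛' : LocalLagrangians T g V)
    (𝓛 : LocalLagrangians T g U) (r : κ → ι) : Prop :=
  ∀ j, V j ≤ U (r j) ∧ T.LeafwiseAffine (𝓛'.L j - 𝓛.L (r j)) (V j)

/-- The `1`-forms `θ_(L i)` glue up to the global `1`-form `θ`. -/
def ThetaGlueTo (𝓛 : LocalLagrangians T g U) (θ : OneForm n M) : Prop :=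
  SmoothForm θ Set.univ ∧ ∀ i, ∀ x ∈ U i, θ x = T.theta (𝓛.L i) x

end LocalLagrangians

/-! ### Differential forms and locally Lagrangian-symplectic structures -/

variable (n) in
/-- A differential form of degree `k` on `M` (no regularity). -/
abbrev KForm (k : ℕ) (M : Type u) [TopologicalSpace M] [ChartedSpace (Model n) M] : Type u :=
  ∀ x : M, TangentSpace 𝓘(ℝ, Model n) x [⋀^Fin k]→L[ℝ] ℝ

/-- A differential form is smooth. -/
def SmoothKForm {k : ℕ} (η : KForm n k M) : Prop :=
  ContMDiff 𝓘(ℝ, Model n) (𝓘(ℝ, Model n).prod 𝓘(ℝ, Model n [⋀^Fin k]→L[ℝ] ℝ)) ∞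
    (fun x => TotalSpace.mk' (Model n [⋀^Fin k]→L[ℝ] ℝ)
      (E := fun x : M => TangentSpace 𝓘(ℝ, Model n) x [⋀^Fin k]→L[ℝ] ℝ) x (η x))

/-- A `1`-form as a differential form of degree `1`. -/
def OneForm.toKForm (η : OneForm n M) : KForm n 1 M :=
  fun x => ContinuousAlternatingMap.ofSubsingleton ℝ _ ℝ (0 : Fin 1) (η x)

/-- The exterior differential, computed at `x` in the preferred chart at `x`. -/
def extD {k : ℕ} (η : KForm n k M) : KForm n (k + 1) M := fun x =>
  ContinuousAlternatingMap.compContinuousLinearMap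
    (extDeriv (fun u : Model n =>
      ContinuousAlternatingMap.compContinuousLinearMap (η ((chartAt (Model n) x).symm u))
        (mfderiv 𝓘(ℝ, Model n) 𝓘(ℝ, Model n) (chartAt (Model n) x).symm u :
          Model n →L[ℝ] TangentSpace 𝓘(ℝ, Model n) ((chartAt (Model n) x).symm u)))
      (chartAt (Model n) x x))
    (mfderiv 𝓘(ℝ, Model n) 𝓘(ℝ, Model n) (chartAt (Model n) x) x :
      TangentSpace 𝓘(ℝ, Model n) x →L[ℝ] Model n)

/-- The `2`-form `ω_L = dθ_L` of a Lagrangian. -/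
def TangentStructure.omega (T : TangentStructure n M) (L : M → ℝ) : KForm n 2 M :=
  extD (OneForm.toKForm (T.theta L))

/-- `Ω` is a symplectic form compatible with the tangent structure, i.e. it is a locally
Lagrangian-symplectic form. -/
structure IsLocallyLagrangianSymplectic (T : TangentStructure n M) (Ω : KForm n 2 M) : Prop where
  smooth : SmoothKForm Ω
  closed : ∀ x, extD Ω x = 0
  nondegenerate : ∀ x v, (∀ w, Ω x ![v, w] = 0) → v = 0
  compatible : ∀ x v w, Ω x ![v, T.S x w] = Ω x ![w, T.S x v]

/-! ### Normal bundles and the operator `d''` -/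

/-- A normal bundle `N` of the vertical foliation, `TM = N ⊕ im S`, given by the projection `P` of
`TM` onto `im S` along `N = ker P`. -/
structure NormalBundle (T : TangentStructure n M) where
  P : EndField n M
  smooth : SmoothEnd P
  idem : ∀ x v, P x (P x v) = P x v
  range_eq : ∀ x, (P x).range = (T.S x).range

namespace NormalBundle

variable {T : TangentStructure n M} (N : NormalBundle T)

/-- `d''f`, the component of type `(0,1)` of `df`. -/
def dpp (f : M → ℝ) : OneForm n M := fun x => (diff n f x).comp (N.P x)

/-- A smooth `1`-form of type `(0,1)`, i.e. one that vanishes on `N`. -/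
def IsType01 (η : OneForm n M) : Prop :=
  SmoothForm η Set.univ ∧ ∀ x v, N.P x v = 0 → η x v = 0

/-- A `1`-form `η` of type `(0,1)` is `d''`-closed: the component of type `(0,2)` of `dη`
vanishes. -/
def IsDppClosed (η : OneForm n M) : Prop :=
  ∀ x v w, extD η.toKForm x ![N.P x v, N.P x w] = 0

/-- The class `c ∈ H¹(M, Φ)` is represented by the `d''`-closed form `η` of type `(0,1)` under the
de Rham isomorphism of the resolution `0 → Φ → Ω^(0,0) → Ω^(0,1) → ⋯` by `d''`: on some open
covering, `η = d''(f i)` for smooth functions `f i`, and `c` is the class of the cocycle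
`f j - f i`. -/
def Represents (η : OneForm n M) (c : T.foliatedFunctions.H1) : Prop :=
  ∃ (ι : Type u) (U : ι → Opens M) (hU : ∀ x, ∃ i, x ∈ U i) (f : ι → M → ℝ)
    (z : T.foliatedFunctions.cocycles U),
    (∀ i, SmoothFun n (f i) (U i)) ∧ (∀ i, ∀ x ∈ U i, η x = N.dpp (f i) x) ∧
    (∀ i j, ∀ x ∈ U i ⊓ U j, z.1 i j x = f j x - f i x) ∧
    c = T.foliatedFunctions.classOf U hU z

end NormalBundle

end Manifold

end LagrangeGeometry

end

open LagrangeGeometry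

/-!
Every assertion about cohomology reduces to explicit cocycles. Two cocycles on two coverings have
the same class once they differ, on the fourfold intersections, by the coboundary of sections over
the intersections of the members (`SectionSheaf.classOf_eq_classOf`), and a cocycle whose class
vanishes is already a coboundary on its own covering
(`SectionSheaf.coboundary_of_classOf_eq_zero`).

If the first obstruction vanishes, then `θ_(L j - L i) = η j - η i` with foliated forms `η i`. In an
adapted chart `η = ∑ ηᵢ dxⁱ` is `θ` of the leafwise affine function `∑ ηᵢ yⁱ`
(`theta_affinePrimitive`); subtraction of these functions from the Lagrangians makes the forms `θ`
agree on overlaps and does not change the Hessians. Conversely, if the forms `θ` of the `L' j`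
agree, the forms `θ_(L' j - L i)` exhibit the cocycle `θ_(L j - L i)` as a coboundary.

Computations with forms are carried out on the coordinate vector fields of a chart. They commute,
whence `dθ(X, Y) = X(θ(Y)) - Y(θ(X))` (`extD_coordField`), and in an adapted chart they are foliated
and stable under `S`. This formula gives `Ω(X, SY) = -g(X, Y)` for `Ω = dθ`
(`LocalLagrangians.extD_apply_S`), so that `Ω` is compatible with `S` because `g` is symmetric, and
it is nondegenerate because `g` is nondegenerate on the transversal bundle. Since `extD` is
computed at every point in the preferred chart of that point, the smoothness and closedness of `Ω`
use its independence of the chart (`extD_eq`), i.e. that the exterior derivative commutes with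
pullbacks.

Finally, `d''f` and `θ_f` both encode the restriction of `df` to the leaves
(`NormalBundle.dpp_eq_dpp_iff`). Hence the `d''(L' j)` agree on overlaps as soon as the `θ_(L' j)`
do, and functions with the same `d''` differ by a foliated function. This yields the form `κ` and
the uniqueness of its class, and the functions `L' j - L i` show that the image of that class in
`H¹(M, A⁰)` is the total obstruction.
-/

noncomputable section

namespace LagrangeGeometry

/-! ### Čech classes of cocycles on arbitrary coverings -/

namespace PointedCover

variable {X : Type u} [TopologicalSpace X]

/-- The intersections of the members of two pointed coverings. -/
def inf (A B : PointedCover X) : PointedCover X where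
  U x := A.U x ⊓ B.U x
  mem x := ⟨A.mem x, B.mem x⟩

theorem le_inf_left (A B : PointedCover X) : A ≤ A.inf B := fun _ => inf_le_left

theorem le_inf_right (A B : PointedCover X) : B ≤ A.inf B := fun _ => inf_le_right

instance : IsDirectedOrder (PointedCover X) :=
  ⟨fun A B => ⟨A.inf B, le_inf_left A B, le_inf_right A B⟩⟩

end PointedCover

namespace SectionSheaf

variable {X : Type u} [TopologicalSpace X] {V : X → Type v} [∀ x, AddCommGroup (V x)]
  {V' : X → Type w} [∀ x, AddCommGroup (V' x)]

instance (F : SectionSheaf X V) :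
    DirectedSystem (fun A : PointedCover X => F.H1Cover A.U) (fun _ _ h => F.restrictH1 h) where
  map_self A x := by
    obtain ⟨c, rfl⟩ := QuotientAddGroup.mk_surjective x
    rfl
  map_map A B C hAB hBC x := by
    obtain ⟨c, rfl⟩ := QuotientAddGroup.mk_surjective x
    rfl

/-- Two cocycles on two coverings that differ, on all the fourfold intersections, by the
coboundary of a family of sections over the `U i ∩ W j` have the same cohomology class. -/
theorem classOf_eq_classOf (F : SectionSheaf X V) {ι κ : Type*} {U : ι → Opens X}
    {W : κ → Opens X} (hU : ∀ x, ∃ i, x ∈ U i) (hW : ∀ x, ∃ j, x ∈ W j) (c : F.cocycles U)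
    (d : F.cocycles W) (h : ι → κ → ∀ x, V x) (hmem : ∀ i j, h i j ∈ F.sec (U i ⊓ W j))
    (heq : ∀ i i' j j' x, x ∈ U i → x ∈ U i' → x ∈ W j → x ∈ W j' →
      c.1 i i' x - d.1 j j' x = h i' j' x - h i j x) :
    F.classOf U hU c = F.classOf W hW d := by
  unfold classOf
  set A := PointedCover.select U hU
  set B := PointedCover.select W hW
  rw [← AddCommGroup.DirectLimit.of_f (f := fun (A B : PointedCover X) (h : A ≤ B) =>
      F.restrictH1 h) (PointedCover.le_inf_left A B),
    ← AddCommGroup.DirectLimit.of_f (f := fun (A B : PointedCover X) (h : A ≤ B) =>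
      F.restrictH1 h) (PointedCover.le_inf_right A B)]
  refine congrArg _ (QuotientAddGroup.eq.2 ?_)
  refine ⟨fun x => -h (hU x).choose (hW x).choose, fun x => (F.sec _).neg_mem (hmem _ _), ?_⟩
  rintro x y z ⟨⟨hxU, hxW⟩, ⟨hyU, hyW⟩⟩
  have := heq (hU x).choose (hU y).choose (hW x).choose (hW y).choose z hxU hyU hxW hyW
  change -c.1 (hU x).choose (hU y).choose z + d.1 (hW x).choose (hW y).choose z =
    -h (hU y).choose (hW y).choose z - -h (hU x).choose (hW x).choose z
  rw [← neg_sub (-h (hU x).choose (hW x).choose z), neg_sub_neg, ← this]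
  abel

theorem classOf_zero (F : SectionSheaf X V) {ι : Type*} {U : ι → Opens X}
    (hU : ∀ x, ∃ i, x ∈ U i) : F.classOf U hU 0 = 0 :=
  map_zero _

/-- In degree one, the cohomology of a covering injects into the cohomology of the space: a
cocycle that becomes a coboundary on a refinement `B` is a coboundary, since the sections
`h x - c x i` over `B x ∩ U i`, which are independent of `x` on overlaps, glue to sections over
`U i`. -/
theorem coboundary_of_classOf_eq_zero (F : SectionSheaf X V) {ι : Type*} {U : ι → Opens X}
    (hU : ∀ x, ∃ i, x ∈ U i) (c : F.cocycles U) (hc : F.classOf U hU c = 0) :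
    c.1 ∈ F.coboundaries U := by
  obtain ⟨B, hB, hB0⟩ := AddCommGroup.DirectLimit.of.zero_exact _ _ hc
  obtain ⟨h, hh, hh'⟩ := (QuotientAddGroup.eq_zero_iff _).1 hB0
  have hBU : ∀ x, B.U x ≤ U (hU x).choose := hB
  have hh' : ∀ x y, ∀ z ∈ B.U x ⊓ B.U y,
      c.1 (hU x).choose (hU y).choose z = h y z - h x z := hh'
  have hglue : ∀ i, ∀ x y z, z ∈ U i → z ∈ B.U x → z ∈ B.U y →
      h x z + c.1 (hU x).choose i z = h y z + c.1 (hU y).choose i z := by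
    intro i x y z hz hx hy
    have h1 := hh' x y z ⟨hx, hy⟩
    have h2 := c.2.2 (hU x).choose (hU y).choose i z ⟨⟨hBU x hx, hBU y hy⟩, hz⟩
    rw [← h2, h1]
    abel
  refine ⟨fun i z => h z z + c.1 (hU z).choose i z, fun i => F.locality fun x hx =>
    ⟨B.U x ⊓ U i, ⟨B.mem x, hx⟩, ?_⟩, ?_⟩
  · refine F.congr (s := h x + c.1 (hU x).choose i) (fun z hz => ?_)
      ((F.sec _).add_mem (F.mono inf_le_left (hh x))
        (F.mono (inf_le_inf_right _ (hBU x)) (c.2.1 _ _)))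
    exact hglue i x z z hz.2 hz.1 (B.mem z)
  · rintro i j z ⟨hi, hj⟩
    change c.1 i j z = h z z + c.1 (hU z).choose j z - (h z z + c.1 (hU z).choose i z)
    rw [← c.2.2 (hU z).choose i j z ⟨⟨hBU z (B.mem z), hi⟩, hj⟩]
    abel

/-- The image of a cocycle under a morphism of sheaves. -/
def Hom.mapCocycle {F : SectionSheaf X V} {G : SectionSheaf X V'} (φ : Hom F G) {ι : Type*}
    {U : ι → Opens X} (c : F.cocycles U) : G.cocycles U :=
  ⟨fun i j => φ.map (c.1 i j), fun i j => φ.map_mem (c.2.1 i j), fun i j k =>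
    φ.map_add_eq (F.mono inf_le_left (c.2.1 i j))
      (F.mono (le_inf (inf_le_left.trans inf_le_right) inf_le_right) (c.2.1 j k)) (c.2.2 i j k)⟩

theorem Hom.mapH1_classOf {F : SectionSheaf X V} {G : SectionSheaf X V'} (φ : Hom F G)
    {ι : Type*} {U : ι → Opens X} (hU : ∀ x, ∃ i, x ∈ U i) (c : F.cocycles U) :
    φ.mapH1 (F.classOf U hU c) = G.classOf U hU (φ.mapCocycle c) :=
  AddCommGroup.DirectLimit.map_apply_of _ _ _

end SectionSheaf

section

variable {n : ℕ} {M : Type u} [TopologicalSpace M] [ChartedSpace (Model n) M]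

/-! ### Coordinate vector fields of a chart -/

/-- The differential of a chart at a point of `M`. -/
def dchart (φ : OpenPartialHomeomorph M (Model n)) (x : M) :
    TangentSpace 𝓘(ℝ, Model n) x →L[ℝ] Model n :=
  mfderiv 𝓘(ℝ, Model n) 𝓘(ℝ, Model n) φ x

/-- The differential of the inverse of a chart at a point of the model space. -/
def dsymm (φ : OpenPartialHomeomorph M (Model n)) (p : Model n) :
    Model n →L[ℝ] TangentSpace 𝓘(ℝ, Model n) (φ.symm p) :=
  mfderiv 𝓘(ℝ, Model n) 𝓘(ℝ, Model n) φ.symm p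

/-- The vector field with constant components `c` in the chart `φ`.  It is defined everywhere, but
only its values on the source of `φ` are meaningful. -/
def coordField (φ : OpenPartialHomeomorph M (Model n)) (c : Model n) : VField n M :=
  VectorField.mpullback 𝓘(ℝ, Model n) 𝓘(ℝ, Model n) φ (fun _ => c)

theorem mdifferentiable_chart {φ : OpenPartialHomeomorph M (Model n)}
    (hφ : φ ∈ IsManifold.maximalAtlas 𝓘(ℝ, Model n) ∞ M) :
    φ.MDifferentiable 𝓘(ℝ, Model n) 𝓘(ℝ, Model n) :=
  ⟨(contMDiffOn_of_mem_maximalAtlas hφ).mdifferentiableOn (by simp),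
    (contMDiffOn_symm_of_mem_maximalAtlas hφ).mdifferentiableOn (by simp)⟩

theorem contDiffAt_comp_symm {φ : OpenPartialHomeomorph M (Model n)}
    (hφ : φ ∈ IsManifold.maximalAtlas 𝓘(ℝ, Model n) ∞ M) {f : M → ℝ} {W : Opens M}
    (hf : SmoothFun n f W) {p : Model n} (hp : p ∈ φ.target) (hpW : φ.symm p ∈ W) :
    ContDiffAt ℝ ∞ (f ∘ φ.symm) p :=
  ((hf.contMDiffAt (W.isOpen.mem_nhds hpW)).comp p
    (contMDiffAt_symm_of_mem_maximalAtlas hφ hp)).contDiffAt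

theorem eventually_symm_mem {X : Type*} [TopologicalSpace X] {E : Type*} [TopologicalSpace E]
    {φ : OpenPartialHomeomorph X E} {x : X} (hx : x ∈ φ.source) {W : Opens X} (hxW : x ∈ W) :
    ∀ᶠ p in 𝓝 (φ x), p ∈ φ.target ∧ φ.symm p ∈ W := by
  refine Filter.Eventually.and (φ.open_target.mem_nhds (φ.map_source hx)) ?_
  refine (φ.continuousAt_symm (φ.map_source hx)).preimage_mem_nhds ?_
  rw [φ.left_inv hx]
  exact W.isOpen.mem_nhds hxW

section Chart

variable {φ : OpenPartialHomeomorph M (Model n)}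
  (hφ : φ ∈ IsManifold.maximalAtlas 𝓘(ℝ, Model n) ∞ M)

include hφ

theorem dchart_injective {x : M} (hx : x ∈ φ.source) : Function.Injective (dchart φ x) :=
  (mdifferentiable_chart hφ).mfderiv_injective hx

theorem dchart_dsymm {p : Model n} (hp : p ∈ φ.target) (c : Model n) :
    dchart φ (φ.symm p) (dsymm φ p c) = c :=
  DFunLike.congr_fun ((mdifferentiable_chart hφ).comp_symm_deriv hp) c

theorem dchart_coordField {x : M} (hx : x ∈ φ.source) (c : Model n) :
    dchart φ x (coordField φ c x) = c :=
  ContinuousLinearMap.IsInvertible.self_apply_inverse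
    ⟨(mdifferentiable_chart hφ).mfderiv hx, rfl⟩ c

theorem coordField_eq_of_dchart_eq {x : M} (hx : x ∈ φ.source) {c : Model n}
    {v : TangentSpace 𝓘(ℝ, Model n) x} (h : dchart φ x v = c) : coordField φ c x = v :=
  dchart_injective hφ hx ((dchart_coordField hφ hx c).trans h.symm)

theorem coordField_dchart {x : M} (hx : x ∈ φ.source) (v : TangentSpace 𝓘(ℝ, Model n) x) :
    coordField φ (dchart φ x v) x = v :=
  coordField_eq_of_dchart_eq hφ hx rfl

theorem dsymm_eq_coordField {p : Model n} (hp : p ∈ φ.target) (c : Model n) :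
    dsymm φ p c = coordField φ c (φ.symm p) :=
  (coordField_eq_of_dchart_eq hφ (φ.map_target hp) (dchart_dsymm hφ hp c)).symm

variable [IsManifold 𝓘(ℝ, Model n) ∞ M]

theorem smoothField_coordField (c : Model n) : SmoothField (coordField φ c) φ.source := by
  intro y hy
  refine (ContMDiffAt.mpullback_vectorField_preimage (n := ∞) ?_
    (contMDiffAt_of_mem_maximalAtlas hφ hy) ⟨(mdifferentiable_chart hφ).mfderiv hy, rfl⟩
    (by simp)).contMDiffWithinAt
  exact contMDiffAt_vectorSpace_iff_contDiffAt.2 contDiffAt_const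

/-- The differential of a function is computed by its expression in the chart `φ`. -/
theorem diff_eq_fderiv {f : M → ℝ} {W : Opens M} (hf : SmoothFun n f W) {x : M}
    (hx : x ∈ φ.source) (hxW : x ∈ W) (v : TangentSpace 𝓘(ℝ, Model n) x) :
    diff n f x v = fderiv ℝ (f ∘ φ.symm) (φ x) (dchart φ x v) := by
  have hd : DifferentiableAt ℝ (f ∘ φ.symm) (φ x) :=
    (contDiffAt_comp_symm hφ hf (φ.map_source hx) (by rwa [φ.left_inv hx])).differentiableAt
      (by simp)
  rw [diff_congr (U := ⟨φ.source, φ.open_source⟩) (g := (f ∘ φ.symm) ∘ φ)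
    (fun z hz => by simp [φ.left_inv (show z ∈ φ.source from hz)]) hx]
  exact diff_comp_chart hφ hx hd v

theorem diff_diff_coordField {f : M → ℝ} {W : Opens M} (hf : SmoothFun n f W) {x : M}
    (hx : x ∈ φ.source) (hxW : x ∈ W) (c d : Model n) :
    diff n (fun z => diff n f z (coordField φ c z)) x (coordField φ d x) =
      fderiv ℝ (fderiv ℝ (f ∘ φ.symm)) (φ x) d c := by
  have hs : SmoothFun n (fun z => diff n f z (coordField φ c z))
      (W ⊓ ⟨φ.source, φ.open_source⟩ : Opens M) :=
    smoothFun_apply (diff_smoothOn (hf.mono inf_le_left))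
      ((smoothField_coordField hφ c).mono inf_le_right)
  rw [diff_eq_fderiv hφ hs hx ⟨hxW, hx⟩, dchart_coordField hφ hx]
  have hF : ContDiffAt ℝ ∞ (f ∘ φ.symm) (φ x) :=
    contDiffAt_comp_symm hφ hf (φ.map_source hx) (by rwa [φ.left_inv hx])
  have hd : DifferentiableAt ℝ (fderiv ℝ (f ∘ φ.symm)) (φ x) :=
    (hF.fderiv_right (m := ∞) (by simp)).differentiableAt (by simp)
  have hev : (fun z => diff n f z (coordField φ c z)) ∘ φ.symm =ᶠ[𝓝 (φ x)]
      fun p => fderiv ℝ (f ∘ φ.symm) p c := by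
    filter_upwards [eventually_symm_mem hx hxW] with p hp
    simp only [Function.comp_apply]
    rw [diff_eq_fderiv hφ hf (φ.map_target hp.1) hp.2, dchart_coordField hφ (φ.map_target hp.1),
      φ.right_inv hp.1]
  rw [hev.fderiv_eq, fderiv_clm_apply hd (differentiableAt_const c)]
  simp

/-- Coordinate vector fields of the same chart commute. -/
theorem diff_diff_coordField_comm {f : M → ℝ} {W : Opens M} (hf : SmoothFun n f W) {x : M}
    (hx : x ∈ φ.source) (hxW : x ∈ W) (c d : Model n) :
    diff n (fun z => diff n f z (coordField φ c z)) x (coordField φ d x) =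
      diff n (fun z => diff n f z (coordField φ d z)) x (coordField φ c x) := by
  rw [diff_diff_coordField hφ hf hx hxW, diff_diff_coordField hφ hf hx hxW]
  have hF : ContDiffAt ℝ ∞ (f ∘ φ.symm) (φ x) :=
    contDiffAt_comp_symm hφ hf (φ.map_source hx) (by rwa [φ.left_inv hx])
  exact (hF.isSymmSndFDerivAt
    (by rw [minSmoothness_of_isRCLikeNormedField]; exact ENat.LEInfty.out)) d c

end Chart

variable [IsManifold 𝓘(ℝ, Model n) ∞ M]

/-! ### Adapted charts -/

section Adapted

variable {T : TangentStructure n M} {φ : OpenPartialHomeomorph M (Model n)}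
  (hφ : IsAdaptedChart T.S φ)

include hφ

theorem S_coordField {x : M} (hx : x ∈ φ.source) (c : Model n) :
    T.S x (coordField φ c x) = coordField φ (0, c.1) x := by
  refine (coordField_eq_of_dchart_eq hφ.1 hx ((hφ.2 x hx _).trans ?_)).symm
  exact congrArg (fun d : Model n => ((0, d.1) : Model n)) (dchart_coordField hφ.1 hx c)

theorem coordField_vertical {x : M} (hx : x ∈ φ.source) (b : Fin n → ℝ) :
    coordField φ (0, b) x = T.S x (coordField φ (b, 0) x) :=
  (S_coordField hφ hx (b, 0)).symm

/-- Coordinate vector fields of an adapted chart are foliated, because they commute with the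
vertical coordinate vector fields. -/
theorem foliatedField_coordField (c : Model n) :
    T.FoliatedField (coordField φ c) ⟨φ.source, φ.open_source⟩ := by
  refine ⟨smoothField_coordField hφ.1 c, fun W f hW hf => ⟨smoothFun_apply (diff_smoothOn hf.1)
    ((smoothField_coordField hφ.1 c).mono hW), fun x hx v => ?_⟩⟩
  have hxφ : x ∈ φ.source := hW hx
  rw [← coordField_dchart hφ.1 hxφ v, S_coordField hφ hxφ,
    diff_diff_coordField_comm hφ.1 hf.1 hxφ hx]
  rw [diff_congr (U := W) (g := 0) (fun z hz => ?_) hx, diff_zero]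
  · rfl
  · rw [coordField_vertical hφ (hW hz)]
    exact hf.2 z hz _

end Adapted

end

section

variable {n : ℕ} {M : Type u} [TopologicalSpace M] [ChartedSpace (Model n) M]
  [IsManifold 𝓘(ℝ, Model n) ∞ M] {T : TangentStructure n M}

/-! ### Surjectivity of `π'` over coordinate neighborhoods -/

omit [IsManifold 𝓘(ℝ, Model n) ∞ M] in
theorem eq_sum_coordField {φ : OpenPartialHomeomorph M (Model n)}
    (hφ : φ ∈ IsManifold.maximalAtlas 𝓘(ℝ, Model n) ∞ M) {x : M} (hx : x ∈ φ.source)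
    (v : TangentSpace 𝓘(ℝ, Model n) x) :
    v = ∑ i, (dchart φ x v).1 i • coordField φ (Pi.single i 1, 0) x +
      coordField φ (0, (dchart φ x v).2) x := by
  refine dchart_injective hφ hx ?_
  simp only [map_add, map_sum, map_smul, dchart_coordField hφ hx]
  ext j
  · simp [Prod.fst_sum, Finset.sum_apply, Pi.single_apply]
  · simp [Prod.snd_sum]

theorem diff_finsetSum {ι : Type*} (s : Finset ι) {f : ι → M → ℝ} {U : Opens M}
    (hf : ∀ i ∈ s, SmoothFun n (f i) U) {x : M} (hx : x ∈ U) :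
    diff n (fun z => ∑ i ∈ s, f i z) x = ∑ i ∈ s, diff n (f i) x := by
  classical
  induction s using Finset.induction_on with
  | empty =>
    simp only [Finset.sum_empty]
    exact diff_zero x
  | insert a s ha ih =>
    simp only [Finset.sum_insert ha]
    have h := fun i hi => hf i (Finset.mem_insert_of_mem hi)
    rw [← ih h]
    exact diff_add (hf a (Finset.mem_insert_self a s)) (contMDiffOn_finsetSum h) hx

/-- The leafwise affine function `∑ ηᵢ yⁱ` of a form `η = ∑ ηᵢ dxⁱ` in a chart with coordinates
`(x, y)`. -/
def affinePrimitive (φ : OpenPartialHomeomorph M (Model n)) (η : OneForm n M) : M → ℝ :=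
  fun x => ∑ i, η x (coordField φ (Pi.single i 1, 0) x) * (φ x).2 i

section Primitive

variable {φ : OpenPartialHomeomorph M (Model n)} (hφ : IsAdaptedChart T.S φ) {η : OneForm n M}
  {U : Opens M} (hU : (U : Set M) ⊆ φ.source) (hη : T.FoliatedForm η U)

include hφ hU hη

theorem foliatedFun_coefficient (i : Fin n) :
    T.FoliatedFun (fun x => η x (coordField φ (Pi.single i 1, 0) x)) U :=
  hη.2.2 U _ le_rfl ((foliatedField_coordField hφ _).mono hU)

omit hη in
theorem smoothFun_snd (i : Fin n) : SmoothFun n (fun x => (φ x).2 i) U := by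
  have h : ContDiff ℝ ∞ (fun p : Model n => p.2 i) := by fun_prop
  exact (h.contMDiff.comp_contMDiffOn (contMDiffOn_of_mem_maximalAtlas hφ.1)).mono hU

omit hη in
theorem diff_snd (i : Fin n) {x : M} (hx : x ∈ U) (v : TangentSpace 𝓘(ℝ, Model n) x) :
    diff n (fun x => (φ x).2 i) x v = (dchart φ x v).2 i := by
  let p : Model n →L[ℝ] ℝ := (ContinuousLinearMap.proj i).comp (ContinuousLinearMap.snd ℝ _ _)
  refine (diff_comp_chart hφ.1 (h := p) (hU hx) p.differentiableAt v).trans ?_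
  rw [p.fderiv]
  rfl

theorem smoothFun_affinePrimitive : SmoothFun n (affinePrimitive φ η) U :=
  contMDiffOn_finsetSum fun i _ =>
    ContMDiffOn.mul (foliatedFun_coefficient hφ hU hη i).1 (smoothFun_snd hφ hU i)

theorem theta_affinePrimitive {x : M} (hx : x ∈ U) : T.theta (affinePrimitive φ η) x = η x := by
  ext v
  have hmd : ∀ {f : M → ℝ}, SmoothFun n f U → MDifferentiableAt 𝓘(ℝ, Model n) 𝓘(ℝ, ℝ) f x :=
    fun hf => (hf.contMDiffAt (U.isOpen.mem_nhds hx)).mdifferentiableAt (by simp)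
  have hd : ∀ i, diff n (fun z => η z (coordField φ (Pi.single i 1, 0) z) * (φ z).2 i) x
      (T.S x v) = (dchart φ x v).1 i * η x (coordField φ (Pi.single i 1, 0) x) := by
    intro i
    have h := foliatedFun_coefficient hφ hU hη i
    unfold diff
    rw [mvfderiv_fun_mul (hmd h.1) (hmd (smoothFun_snd hφ hU i))]
    have h0 := h.2 x hx v
    have h1 := diff_snd hφ hU i hx (T.S x v)
    have h2 : dchart φ x (T.S x v) = (0, (dchart φ x v).1) := hφ.2 x (hU hx) v
    rw [h2] at h1
    unfold diff at h0 h1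
    simp only [add_apply, smul_apply, h0, h1, smul_eq_mul]
    ring
  have hsum : diff n (affinePrimitive φ η) x (T.S x v) = ∑ i, diff n
      (fun z => η z (coordField φ (Pi.single i 1, 0) z) * (φ z).2 i) x (T.S x v) := by
    rw [show affinePrimitive φ η = fun z =>
      ∑ i, η z (coordField φ (Pi.single i 1, 0) z) * (φ z).2 i from rfl,
      diff_finsetSum _ (f := fun i z => η z (coordField φ (Pi.single i 1, 0) z) * (φ z).2 i)
        (fun i _ => ContMDiffOn.mul (foliatedFun_coefficient hφ hU hη i).1
        (smoothFun_snd hφ hU i)) hx, sum_apply]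
  change diff n (affinePrimitive φ η) x (T.S x v) = η x v
  rw [hsum]
  conv_rhs => rw [eq_sum_coordField hφ.1 (hU hx) v]
  rw [map_add, map_sum, coordField_vertical hφ (hU hx), hη.2.1 x hx, add_zero]
  simp only [map_smul, hd, smul_eq_mul]

theorem leafwiseAffine_affinePrimitive : T.LeafwiseAffine (affinePrimitive φ η) U :=
  ⟨smoothFun_affinePrimitive hφ hU hη, fun W X hW hX => (hη.2.2 W X hW hX).congr fun x hx =>
    (DFunLike.congr_fun (theta_affinePrimitive hφ hU hη (hW hx)) (X x)).symm⟩

end Primitive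

/-! ### Local Lagrangians up to leafwise affine functions -/

theorem theta_sub {f h : M → ℝ} {U : Opens M} (hf : SmoothFun n f U) (hh : SmoothFun n h U)
    {x : M} (hx : x ∈ U) : T.theta (f - h) x = T.theta f x - T.theta h x := by
  unfold TangentStructure.theta
  rw [diff_sub hf hh hx, ContinuousLinearMap.sub_comp]

theorem TangentStructure.IsHessian.sub_leafwiseAffine {L h : M → ℝ} {U : Opens M}
    {g : ∀ x : M, TangentSpace 𝓘(ℝ, Model n) x →L[ℝ] TangentSpace 𝓘(ℝ, Model n) x →L[ℝ] ℝ}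
    (hL : T.IsHessian L U g) (hLs : SmoothFun n L U) (hh : T.LeafwiseAffine h U) :
    T.IsHessian (L - h) U g := by
  intro W X Y hW hX hY x hx
  have hs : SmoothFun n (fun z => diff n L z (T.S z (X z))) W :=
    smoothFun_apply (η := T.theta L) (TangentStructure.smoothForm_theta (hLs.mono hW)) hX.1
  have hfol := hh.2 W X hW hX
  rw [hL W X Y hW hX hY x hx, diff_congr (f := fun z => diff n (L - h) z (T.S z (X z)))
    (g := (fun z => diff n L z (T.S z (X z))) - fun z => diff n h z (T.S z (X z)))
    (fun z hz => by rw [diff_sub hLs hh.1 (hW hz)]; rfl) hx, diff_sub hs hfol.1 hx, sub_apply,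
    hfol.2 x hx, sub_zero]

variable {g : TransversalMetric T} {ι : Type*} {κ : Type*} {U : ι → Opens M} {V : κ → Opens M}

namespace LocalLagrangians

/-- The local Lagrangians obtained by restriction to a refinement of the covering and subtraction
of leafwise affine functions. -/
def subAffine (𝓛 : LocalLagrangians T g U) (r : κ → ι) (hV : ∀ j, V j ≤ U (r j))
    (hcover : ∀ x, ∃ j, x ∈ V j) (h : κ → M → ℝ) (hh : ∀ j, T.LeafwiseAffine (h j) (V j)) :
    LocalLagrangians T g V where
  L j := 𝓛.L (r j) - h j
  cover := hcover
  smooth j := ContMDiffOn.sub ((𝓛.smooth (r j)).mono (hV j)) (hh j).1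
  hessian j := TangentStructure.IsHessian.sub_leafwiseAffine
    (fun W X Y hW => 𝓛.hessian (r j) W X Y (hW.trans (hV j)))
    ((𝓛.smooth (r j)).mono (hV j)) (hh j)

theorem subordinated_subAffine (𝓛 : LocalLagrangians T g U) (r : κ → ι) (hV : ∀ j, V j ≤ U (r j))
    (hcover : ∀ x, ∃ j, x ∈ V j) (h : κ → M → ℝ) (hh : ∀ j, T.LeafwiseAffine (h j) (V j)) :
    (𝓛.subAffine r hV hcover h hh).Subordinated 𝓛 r := fun j =>
  ⟨hV j, T.leafwiseAffineFunctions.congr (s := -h j) (fun x _ => by simp [subAffine])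
    ((T.leafwiseAffineFunctions.sec _).neg_mem (hh j))⟩

theorem exists_thetaGlueTo (𝓛 : LocalLagrangians T g U)
    (h : ∀ i j, ∀ x ∈ U i ⊓ U j, T.theta (𝓛.L i) x = T.theta (𝓛.L j) x) :
    ∃ θ, 𝓛.ThetaGlueTo θ := by
  have hθ : ∀ i, ∀ x ∈ U i, T.theta (𝓛.L (𝓛.cover x).choose) x = T.theta (𝓛.L i) x :=
    fun i x hx => h _ _ x ⟨(𝓛.cover x).choose_spec, hx⟩
  refine ⟨fun x => T.theta (𝓛.L (𝓛.cover x).choose) x, fun x _ => ?_, hθ⟩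
  obtain ⟨i, hi⟩ := 𝓛.cover x
  have hs : SmoothForm (T.theta (𝓛.L i)) (U i : Set M) :=
    TangentStructure.smoothForm_theta (𝓛.smooth i)
  have hs' : SmoothForm (fun x => T.theta (𝓛.L (𝓛.cover x).choose) x) (U i : Set M) :=
    ContMDiffOn.congr hs fun y hy =>
      congrArg _ (hθ i y hy)
  exact (ContMDiffOn.contMDiffAt hs' ((U i).isOpen.mem_nhds hi)).contMDiffWithinAt

/-- On the overlaps, local Lagrangians with the same `θ` differ by foliated functions. -/
theorem foliatedFun_sub {f h : M → ℝ} {W : Opens M} (hf : SmoothFun n f W) (hh : SmoothFun n h W)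
    (heq : ∀ x ∈ W, T.theta f x = T.theta h x) : T.FoliatedFun (f - h) W :=
  ⟨ContMDiffOn.sub hf hh, fun x hx v => by
    change T.theta (f - h) x v = 0
    rw [theta_sub hf hh hx, heq x hx, sub_self]
    rfl⟩

end LocalLagrangians

end

section

variable {n : ℕ} {M : Type u} [TopologicalSpace M] [ChartedSpace (Model n) M]

/-! ### The exterior differential in an arbitrary chart -/

/-- The expression of a differential form in a chart; only its values on the target of the chart
are meaningful. -/
def coordRep (φ : OpenPartialHomeomorph M (Model n)) {k : ℕ} (η : KForm n k M) :
    Model n → Model n [⋀^Fin k]→L[ℝ] ℝ := fun p =>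
  (η (φ.symm p)).compContinuousLinearMap (dsymm φ p)

variable [IsManifold 𝓘(ℝ, Model n) ∞ M]

section

variable {φ ψ : OpenPartialHomeomorph M (Model n)}
  (hφ : φ ∈ IsManifold.maximalAtlas 𝓘(ℝ, Model n) ∞ M)
  (hψ : ψ ∈ IsManifold.maximalAtlas 𝓘(ℝ, Model n) ∞ M)

include hφ

omit [IsManifold 𝓘(ℝ, Model n) ∞ M] in
theorem coordRep_apply {k : ℕ} (η : KForm n k M) {p : Model n} (hp : p ∈ φ.target)
    (c : Fin k → Model n) :
    coordRep φ η p c = η (φ.symm p) (fun i => coordField φ (c i) (φ.symm p)) :=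
  congrArg (η (φ.symm p)) (funext fun i => dsymm_eq_coordField hφ hp (c i))

theorem contDiffAt_coordRep {θ : OneForm n M} {W : Opens M} (hθ : SmoothForm θ (W : Set M))
    {p : Model n} (hp : p ∈ φ.target) (hpW : φ.symm p ∈ W) :
    ContDiffAt ℝ ∞ (coordRep φ θ.toKForm) p := by
  have hopen : IsOpen (φ.target ∩ φ.symm ⁻¹' W) := φ.isOpen_inter_preimage_symm W.isOpen
  refine ContDiffOn.contDiffAt ?_ (hopen.mem_nhds ⟨hp, hpW⟩)
  have h : ContDiffOn ℝ ∞ (fun q => (θ (φ.symm q)).comp (dsymm φ q) : Model n → Model n →L[ℝ] ℝ)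
      (φ.target ∩ φ.symm ⁻¹' W) := by
    refine contDiffOn_clm_apply.2 fun c => ?_
    refine ContDiffOn.congr (f := (fun x => θ x (coordField φ c x)) ∘ φ.symm) (fun q hq => ?_)
      fun q hq => ?_
    · have hs : SmoothFun n (fun x => θ x (coordField φ c x))
          (W ⊓ ⟨φ.source, φ.open_source⟩ : Opens M) :=
        smoothFun_apply (hθ.mono inf_le_left) ((smoothField_coordField hφ c).mono inf_le_right)
      exact (contDiffAt_comp_symm hφ hs hq.1 ⟨hq.2, φ.map_target hq.1⟩).contDiffWithinAt
    · exact congrArg (θ (φ.symm q)) (dsymm_eq_coordField hφ hq.1 c)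
  exact (ContinuousAlternatingMap.ofSubsingletonLIE (𝕜 := ℝ)
    (E := Model n) (F := ℝ) (0 : Fin 1)).contDiff.comp_contDiffOn h

include hψ

omit [IsManifold 𝓘(ℝ, Model n) ∞ M] in
theorem dchart_dsymm_eq_fderiv {p : Model n} (hp : p ∈ ψ.target) (hpφ : ψ.symm p ∈ φ.source)
    (c : Model n) : dchart φ (ψ.symm p) (dsymm ψ p c) = fderiv ℝ (φ ∘ ψ.symm) p c := by
  rw [← mfderiv_eq_fderiv, mfderiv_comp p ((mdifferentiable_chart hφ).mdifferentiableAt hpφ)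
    ((mdifferentiable_chart hψ).mdifferentiableAt_symm hp)]
  rfl

omit [IsManifold 𝓘(ℝ, Model n) ∞ M] in
theorem fderiv_dchart {x : M} (hxφ : x ∈ φ.source) (hxψ : x ∈ ψ.source)
    (v : TangentSpace 𝓘(ℝ, Model n) x) :
    fderiv ℝ (φ ∘ ψ.symm) (ψ x) (dchart ψ x v) = dchart φ x v := by
  rw [← dchart_dsymm_eq_fderiv hφ hψ (ψ.map_source hxψ) (by rwa [ψ.left_inv hxψ]),
    dsymm_eq_coordField hψ (ψ.map_source hxψ), ψ.left_inv hxψ, coordField_dchart hψ hxψ]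

omit [IsManifold 𝓘(ℝ, Model n) ∞ M] in
theorem coordRep_change {k : ℕ} (η : KForm n k M) {p : Model n} (hp : p ∈ ψ.target)
    (hpφ : ψ.symm p ∈ φ.source) :
    coordRep ψ η p =
      (coordRep φ η ((φ ∘ ψ.symm) p)).compContinuousLinearMap (fderiv ℝ (φ ∘ ψ.symm) p) := by
  ext c
  rw [ContinuousAlternatingMap.compContinuousLinearMap_apply,
    coordRep_apply hφ η (p := (φ ∘ ψ.symm) p) (φ.map_source hpφ), Function.comp_apply,
    φ.left_inv hpφ]
  refine congrArg (η (ψ.symm p)) (funext fun i => ?_)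
  exact (coordField_eq_of_dchart_eq hφ hpφ (dchart_dsymm_eq_fderiv hφ hψ hp hpφ (c i))).symm

end

theorem chartAt_mem_maximalAtlas (x : M) :
    chartAt (Model n) x ∈ IsManifold.maximalAtlas 𝓘(ℝ, Model n) ∞ M :=
  IsManifold.chart_mem_maximalAtlas x

section

variable {φ : OpenPartialHomeomorph M (Model n)}
  (hφ : φ ∈ IsManifold.maximalAtlas 𝓘(ℝ, Model n) ∞ M)

include hφ

/-- The exterior differential does not depend on the chart in which it is computed. -/
theorem extD_eq {k : ℕ} {η : KForm n k M} {x : M} (hx : x ∈ φ.source)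
    (hη : DifferentiableAt ℝ (coordRep φ η) (φ x)) :
    extD η x =
      (extDeriv (coordRep φ η) (φ x)).compContinuousLinearMap (dchart φ x) := by
  have hψ := chartAt_mem_maximalAtlas (n := n) x
  have hxψ : x ∈ (chartAt (Model n) x).source := mem_chart_source _ x
  have hτ : (φ ∘ (chartAt (Model n) x).symm) (chartAt (Model n) x x) = φ x := by
    simp [(chartAt (Model n) x).left_inv hxψ]
  have hev : coordRep (chartAt (Model n) x) η =ᶠ[𝓝 (chartAt (Model n) x x)] fun p =>
      (coordRep φ η ((φ ∘ (chartAt (Model n) x).symm) p)).compContinuousLinearMap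
        (fderiv ℝ (φ ∘ (chartAt (Model n) x).symm) p) := by
    filter_upwards [eventually_symm_mem hxψ (W := ⟨φ.source, φ.open_source⟩) hx] with p hp
    exact coordRep_change hφ hψ η hp.1 hp.2
  have hsmooth : ContDiffAt ℝ ∞ (φ ∘ (chartAt (Model n) x).symm) (chartAt (Model n) x x) := by
    refine ContMDiffAt.contDiffAt (ContMDiffAt.comp _ ?_
      (contMDiffAt_symm_of_mem_maximalAtlas hψ (mem_chart_target _ x)))
    rw [(chartAt (Model n) x).left_inv hxψ]
    exact contMDiffAt_of_mem_maximalAtlas hφ hx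
  have hη' : DifferentiableAt ℝ (coordRep φ η)
      ((φ ∘ (chartAt (Model n) x).symm) (chartAt (Model n) x x)) := by rwa [hτ]
  have h := extDeriv_pullback hη' hsmooth
    (by rw [minSmoothness_of_isRCLikeNormedField]; exact ENat.LEInfty.out)
  rw [hτ] at h
  change (extDeriv (coordRep (chartAt (Model n) x) η) (chartAt (Model n) x x)
    ).compContinuousLinearMap (dchart (chartAt (Model n) x) x) = _
  rw [hev.extDeriv_eq, h]
  ext v
  simp only [ContinuousAlternatingMap.compContinuousLinearMap_apply]
  exact congrArg _ (funext fun i => fderiv_dchart hφ hψ hx hxψ (v i))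

theorem coordRep_extD {θ : OneForm n M} {W : Opens M} (hθ : SmoothForm θ (W : Set M))
    {p : Model n} (hp : p ∈ φ.target) (hpW : φ.symm p ∈ W) :
    coordRep φ (extD θ.toKForm) p = extDeriv (coordRep φ θ.toKForm) p := by
  ext c
  rw [coordRep_apply hφ _ hp, extD_eq hφ (φ.map_target hp)]
  · rw [φ.right_inv hp]
    refine congrArg _ (funext fun i => dchart_coordField hφ (φ.map_target hp) (c i))
  · rw [φ.right_inv hp]
    exact (contDiffAt_coordRep hφ hθ hp hpW).differentiableAt (by simp)

theorem contDiffAt_coordRep_extD {θ : OneForm n M} (hθ : SmoothForm θ univ)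
    {p : Model n} (hp : p ∈ φ.target) : ContDiffAt ℝ ∞ (coordRep φ (extD θ.toKForm)) p := by
  have hev : coordRep φ (extD θ.toKForm) =ᶠ[𝓝 p] extDeriv (coordRep φ θ.toKForm) :=
    Filter.eventually_of_mem (φ.open_target.mem_nhds hp) fun q hq =>
      coordRep_extD hφ (W := ⊤) hθ hq trivial
  refine ContDiffAt.congr_of_eventuallyEq ?_ hev
  exact (ContinuousAlternatingMap.alternatizeUncurryFinCLM ℝ (Model n) ℝ).contDiff.contDiffAt.comp
    p ((contDiffAt_coordRep hφ (W := ⊤) hθ hp trivial).fderiv_right (m := ∞) (by simp))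

/-- The exterior differential of a `1`-form in terms of coordinate vector fields, which commute:
`dθ(X, Y) = X(θ(Y)) - Y(θ(X))`. -/
theorem extD_coordField {θ : OneForm n M} {W : Opens M} (hθ : SmoothForm θ (W : Set M)) {x : M}
    (hx : x ∈ φ.source) (hxW : x ∈ W) (c d : Model n) :
    extD θ.toKForm x ![coordField φ c x, coordField φ d x] =
      diff n (fun z => θ z (coordField φ d z)) x (coordField φ c x) -
        diff n (fun z => θ z (coordField φ c z)) x (coordField φ d x) := by
  have hxt := φ.map_source hx
  have hd : DifferentiableAt ℝ (coordRep φ θ.toKForm) (φ x) :=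
    (contDiffAt_coordRep hφ hθ hxt (by rwa [φ.left_inv hx])).differentiableAt (by simp)
  have key : ∀ c : Model n, ∀ v : TangentSpace 𝓘(ℝ, Model n) x, ∀ w : Fin 1 → Model n, w 0 = c →
      fderiv ℝ (fun p => coordRep φ θ.toKForm p w) (φ x) (dchart φ x v) =
        diff n (fun z => θ z (coordField φ c z)) x v := by
    rintro c v w rfl
    have hs : SmoothFun n (fun z => θ z (coordField φ (w 0) z))
        (W ⊓ ⟨φ.source, φ.open_source⟩ : Opens M) :=
      smoothFun_apply (hθ.mono inf_le_left)
        ((smoothField_coordField hφ (w 0)).mono inf_le_right)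
    rw [diff_eq_fderiv hφ hs hx ⟨hxW, hx⟩]
    refine DFunLike.congr_fun (Filter.EventuallyEq.fderiv_eq ?_) _
    filter_upwards [φ.open_target.mem_nhds hxt] with p hp
    exact coordRep_apply hφ _ hp w
  rw [extD_eq hφ hx hd, ContinuousAlternatingMap.compContinuousLinearMap_apply,
    extDeriv_apply hd, Fin.sum_univ_two]
  have h0 := key d (coordField φ c x) (Fin.removeNth 0
    (dchart φ x ∘ ![coordField φ c x, coordField φ d x])) (dchart_coordField hφ hx d)
  have h1 := key c (coordField φ d x) (Fin.removeNth 1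
    (dchart φ x ∘ ![coordField φ c x, coordField φ d x])) (dchart_coordField hφ hx c)
  rw [← h0, ← h1]
  simp [sub_eq_add_neg]

end

omit [IsManifold 𝓘(ℝ, Model n) ∞ M] in
theorem extD_congr {η θ : OneForm n M} {W : Opens M} (h : ∀ x ∈ W, η x = θ x) {x : M}
    (hx : x ∈ W) : extD η.toKForm x = extD θ.toKForm x := by
  have hev : coordRep (chartAt (Model n) x) η.toKForm =ᶠ[𝓝 (chartAt (Model n) x x)]
      coordRep (chartAt (Model n) x) θ.toKForm := by
    filter_upwards [eventually_symm_mem (mem_chart_source (Model n) x) hx] with p hp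
    unfold coordRep OneForm.toKForm
    rw [h _ hp.2]
  exact congrArg (fun α => ContinuousAlternatingMap.compContinuousLinearMap α
    (dchart (chartAt (Model n) x) x)) hev.extDeriv_eq

theorem extD_extD {θ : OneForm n M} (hθ : SmoothForm θ univ) (x : M) :
    extD (extD θ.toKForm) x = 0 := by
  have hψ := chartAt_mem_maximalAtlas (n := n) x
  have hxψ : x ∈ (chartAt (Model n) x).source := mem_chart_source _ x
  have hxt := mem_chart_target (Model n) x
  have hev : coordRep (chartAt (Model n) x) (extD θ.toKForm) =ᶠ[𝓝 (chartAt (Model n) x x)]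
      extDeriv (coordRep (chartAt (Model n) x) θ.toKForm) :=
    Filter.eventually_of_mem ((chartAt (Model n) x).open_target.mem_nhds hxt) fun q hq =>
      coordRep_extD hψ (W := ⊤) hθ hq trivial
  rw [extD_eq hψ hxψ ((contDiffAt_coordRep_extD hψ hθ hxt).differentiableAt (by simp)),
    hev.extDeriv_eq, extDeriv_extDeriv_apply (contDiffAt_coordRep hψ (W := ⊤) hθ hxt trivial)
      (by rw [minSmoothness_of_isRCLikeNormedField]; exact ENat.LEInfty.out)]
  rfl

theorem smoothKForm_extD {θ : OneForm n M} (hθ : SmoothForm θ univ) :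
    SmoothKForm (extD θ.toKForm) := by
  intro x
  have hψ := chartAt_mem_maximalAtlas (n := n) x
  refine contMDiffAt_totalSpace.2 ⟨contMDiffAt_id, ?_⟩
  have h : ContMDiffAt 𝓘(ℝ, Model n) 𝓘(ℝ, Model n [⋀^Fin 2]→L[ℝ] ℝ) ∞
      (coordRep (chartAt (Model n) x) (extD θ.toKForm) ∘ chartAt (Model n) x) x :=
    (contDiffAt_coordRep_extD hψ hθ (mem_chart_target _ x)).contMDiffAt.comp x
      (contMDiffAt_of_mem_maximalAtlas hψ (mem_chart_source _ x))
  refine h.congr_of_eventuallyEq ?_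
  filter_upwards [(chartAt (Model n) x).open_source.mem_nhds (mem_chart_source _ x)] with y hy
  ext c
  rw [Function.comp_apply, coordRep_apply hψ _ ((chartAt (Model n) x).map_source hy),
    (chartAt (Model n) x).left_inv hy]
  have hbase : y ∈ (trivializationAt (Model n) (TangentSpace 𝓘(ℝ, Model n)) x).baseSet := hy
  have hsymm : ∀ i, (trivializationAt (Model n) (TangentSpace 𝓘(ℝ, Model n)) x).symmL ℝ y (c i) =
      coordField (chartAt (Model n) x) (c i) y := by
    intro i
    refine (coordField_eq_of_dchart_eq hψ hy ?_).symm
    have h1 := Trivialization.continuousLinearMapAt_symmL (R := ℝ) _ hbase (c i)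
    rw [TangentBundle.continuousLinearMapAt_trivializationAt hy] at h1
    exact h1
  refine Eq.trans ?_ (congrArg (extD θ.toKForm y) (funext hsymm))
  change (trivializationAt ℝ (Bundle.Trivial M ℝ) x).continuousLinearMapAt ℝ y
    (extD θ.toKForm y fun i =>
      (trivializationAt (Model n) (TangentSpace 𝓘(ℝ, Model n)) x).symmL ℝ y (c i)) = _
  simp

end

section

variable {n : ℕ} {M : Type u} [TopologicalSpace M] [ChartedSpace (Model n) M]
  [IsManifold 𝓘(ℝ, Model n) ∞ M] {T : TangentStructure n M} {g : TransversalMetric T}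
  {ι : Type*} {κ : Type*} {U : ι → Opens M} {V : κ → Opens M}

namespace LocalLagrangians

/-! ### The first obstruction -/

theorem Subordinated.leafwiseAffine_sub {𝓛 : LocalLagrangians T g U}
    {𝓛' : LocalLagrangians T g V} {r : κ → ι} (h : 𝓛'.Subordinated 𝓛 r) (j : κ) (i : ι) :
    T.LeafwiseAffine (𝓛'.L j - 𝓛.L i) (V j ⊓ U i) :=
  T.leafwiseAffineFunctions.congr (s := (𝓛'.L j - 𝓛.L (r j)) + (𝓛.L (r j) - 𝓛.L i))
    (fun x _ => by simp) ((T.leafwiseAffineFunctions.sec _).add_mem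
      (T.leafwiseAffineFunctions.mono inf_le_left (h j).2)
      (T.leafwiseAffineFunctions.mono (le_inf inf_le_right (inf_le_left.trans (h j).1))
        (𝓛.leafwiseAffine_sub i (r j))))

theorem firstObstruction_eq_zero_of_thetaGlueTo {𝓛 : LocalLagrangians T g U}
    {𝓛' : LocalLagrangians T g V} {r : κ → ι} (h : 𝓛'.Subordinated 𝓛 r) {θ : OneForm n M}
    (hθ : 𝓛'.ThetaGlueTo θ) : 𝓛.firstObstruction = 0 := by
  unfold firstObstruction totalObstruction
  rw [SectionSheaf.Hom.mapH1_classOf, ← T.foliatedForms.classOf_zero 𝓛'.cover]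
  refine T.foliatedForms.classOf_eq_classOf _ _ _ _
    (fun i j => -T.theta (𝓛'.L j - 𝓛.L i)) (fun i j => (T.foliatedForms.sec _).neg_mem ?_) ?_
  · rw [inf_comm]
    exact T.piPrime.map_mem (h.leafwiseAffine_sub j i)
  · intro i i' j j' x hi hi' hj hj'
    let W : Opens M := (U i ⊓ U i') ⊓ (V j ⊓ V j')
    have hx : x ∈ W := ⟨⟨hi, hi'⟩, ⟨hj, hj'⟩⟩
    have s1 : SmoothFun n (𝓛.L i) W := (𝓛.smooth i).mono (inf_le_left.trans inf_le_left)
    have s2 : SmoothFun n (𝓛.L i') W := (𝓛.smooth i').mono (inf_le_left.trans inf_le_right)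
    have s3 : SmoothFun n (𝓛'.L j) W := (𝓛'.smooth j).mono (inf_le_right.trans inf_le_left)
    have s4 : SmoothFun n (𝓛'.L j') W := (𝓛'.smooth j').mono (inf_le_right.trans inf_le_right)
    change T.theta (𝓛.L i' - 𝓛.L i) x - 0 =
      -T.theta (𝓛'.L j' - 𝓛.L i') x - -T.theta (𝓛'.L j - 𝓛.L i) x
    rw [theta_sub s2 s1 hx, theta_sub s4 s2 hx, theta_sub s3 s1 hx, ← hθ.2 j x hj,
      ← hθ.2 j' x hj']
    abel

/-- If `𝒢₁ = 0`, the cocycle `θ_(L j - L i)` is the coboundary of foliated forms `η i`; over a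
refinement by coordinate neighborhoods, these are `θ` of leafwise affine functions, the subtraction
of which produces local Lagrangians with equal forms `θ`. -/
theorem exists_thetaGlueTo_of_firstObstruction_eq_zero {𝓛 : LocalLagrangians T g U}
    (h0 : 𝓛.firstObstruction = 0) (r : κ → ι) (hV : ∀ j, V j ≤ U (r j))
    (hcover : ∀ x, ∃ j, x ∈ V j)
    (hφ : ∀ j, ∃ φ, IsAdaptedChart T.S φ ∧ (V j : Set M) ⊆ φ.source) :
    ∃ 𝓛' : LocalLagrangians T g V, 𝓛'.Subordinated 𝓛 r ∧ ∃ θ, 𝓛'.ThetaGlueTo θ := by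
  unfold firstObstruction totalObstruction at h0
  rw [SectionSheaf.Hom.mapH1_classOf] at h0
  obtain ⟨η, hη, hη'⟩ := T.foliatedForms.coboundary_of_classOf_eq_zero _ _ h0
  have hη' : ∀ i j, ∀ x ∈ U i ⊓ U j, T.theta (𝓛.L j - 𝓛.L i) x = η j x - η i x := hη'
  choose φ hφ hVφ using hφ
  have hηV : ∀ j, T.FoliatedForm (η (r j)) (V j) := fun j =>
    T.foliatedForms.mono (hV j) (hη (r j))
  have hh := fun j => leafwiseAffine_affinePrimitive (hφ j) (hVφ j) (hηV j)
  refine ⟨𝓛.subAffine r hV hcover _ hh, 𝓛.subordinated_subAffine r hV hcover _ hh,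
    exists_thetaGlueTo _ fun i j x hx => ?_⟩
  have sV : ∀ k, SmoothFun n (𝓛.L (r k)) (V k) := fun k => (𝓛.smooth (r k)).mono (hV k)
  have key : ∀ k, x ∈ V k → T.theta ((𝓛.subAffine r hV hcover _ hh).L k) x =
      T.theta (𝓛.L (r k)) x - η (r k) x := fun k hk => by
    rw [← theta_affinePrimitive (hφ k) (hVφ k) (hηV k) hk, ← theta_sub (sV k) (hh k).1 hk]
    rfl
  have h1 := hη' (r i) (r j) x ⟨hV i hx.1, hV j hx.2⟩
  rw [theta_sub (U := V i ⊓ V j) ((sV j).mono inf_le_right) ((sV i).mono inf_le_left) hx] at h1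
  rw [key i hx.1, key j hx.2, sub_eq_sub_iff_sub_eq_sub, ← neg_sub, h1, neg_sub]

/-! ### The symplectic form -/

/-- The form `Ω = dθ` is determined by `g` on pairs of vectors one of which is vertical. -/
theorem extD_apply_S {𝓛 : LocalLagrangians T g U} {θ : OneForm n M} (hθ : 𝓛.ThetaGlueTo θ)
    (x : M) (v w : TangentSpace 𝓘(ℝ, Model n) x) :
    extD θ.toKForm x ![v, T.S x w] = -g.g x v w := by
  obtain ⟨i, hi⟩ := 𝓛.cover x
  obtain ⟨φ, hφ, hx⟩ := T.integrable x
  let W : Opens M := U i ⊓ ⟨φ.source, φ.open_source⟩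
  have hxW : x ∈ W := ⟨hi, hx⟩
  rw [← coordField_dchart hφ.1 hx v, ← coordField_dchart hφ.1 hx w]
  generalize dchart φ x v = c
  generalize dchart φ x w = d
  have hg := 𝓛.hessian i W (coordField φ c) (coordField φ d) inf_le_left
    ((foliatedField_coordField hφ c).mono inf_le_right)
    ((foliatedField_coordField hφ d).mono inf_le_right) x hxW
  have hvert : diff n (fun z => θ z (coordField φ (0, d.1) z)) x = 0 := by
    rw [diff_congr (U := W) (g := 0) (fun z hz => ?_) hxW, diff_zero]
    rw [coordField_vertical hφ hz.2, hθ.2 i z hz.1]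
    change diff n (𝓛.L i) z (T.S z (T.S z _)) = 0
    rw [T.S_S, map_zero]
  have hc : diff n (fun z => θ z (coordField φ c z)) x =
      diff n (fun z => diff n (𝓛.L i) z (T.S z (coordField φ c z))) x :=
    diff_congr (U := W) (fun z hz => by rw [hθ.2 i z hz.1]; rfl) hxW
  rw [hg, S_coordField hφ hx, extD_coordField hφ.1 (W := ⊤) hθ.1 hx trivial, hvert, hc]
  exact zero_sub _

theorem isLocallyLagrangianSymplectic_extD {𝓛 : LocalLagrangians T g U} {θ : OneForm n M}
    (hθ : 𝓛.ThetaGlueTo θ) : IsLocallyLagrangianSymplectic T (extD θ.toKForm) where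
  smooth := smoothKForm_extD hθ.1
  closed := extD_extD hθ.1
  nondegenerate x v hv := by
    have h1 : v ∈ (T.S x).range := g.nondegenerate x v fun w => by
      rw [← neg_eq_zero, ← extD_apply_S hθ]
      exact hv _
    obtain ⟨u, rfl⟩ := h1
    -- now `Ω(S u, w) = -Ω(w, S u) = g(w, u)`, so that `u` is vertical as well
    have h2 : u ∈ (T.S x).range := g.nondegenerate x u fun w => by
      have hcomp : ![w, T.S x u] ∘ Equiv.swap (0 : Fin 2) 1 = ![T.S x u, w] := by
        ext i
        fin_cases i <;> simp
      have hswap : extD θ.toKForm x ![T.S x u, w] = -extD θ.toKForm x ![w, T.S x u] := by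
        rw [← hcomp]
        exact (extD θ.toKForm x).toAlternatingMap.map_swap ![w, T.S x u] (by simp)
      rw [extD_apply_S hθ, neg_neg] at hswap
      rw [g.symm, ← hswap]
      exact hv w
    obtain ⟨t, rfl⟩ := h2
    exact T.S_S x t
  compatible x v w := by rw [extD_apply_S hθ, extD_apply_S hθ, g.symm]

end LocalLagrangians

/-! ### The class of the form `κ` -/

namespace NormalBundle

variable (N : NormalBundle T)

theorem P_S (x : M) (v : TangentSpace 𝓘(ℝ, Model n) x) : N.P x (T.S x v) = T.S x v := by
  have h : T.S x v ∈ (N.P x).range := by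
    rw [N.range_eq x]
    exact ⟨v, rfl⟩
  obtain ⟨u, hu⟩ := h
  have hu : N.P x u = T.S x v := hu
  rw [← hu, N.idem]

theorem exists_P_eq_S (x : M) (v : TangentSpace 𝓘(ℝ, Model n) x) : ∃ u, N.P x v = T.S x u := by
  have h : N.P x v ∈ (T.S x).range := by
    rw [← N.range_eq x]
    exact ⟨v, rfl⟩
  obtain ⟨u, hu⟩ := h
  exact ⟨u, hu.symm⟩

/-- Both `d''f` and `θ_f` amount to the restriction of `df` to the leaves. -/
theorem dpp_eq_dpp_iff {f h : M → ℝ} {x : M} :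
    N.dpp f x = N.dpp h x ↔ T.theta f x = T.theta h x := by
  constructor <;> intro heq <;> ext v
  · have := DFunLike.congr_fun heq (T.S x v)
    change diff n f x (N.P x (T.S x v)) = diff n h x (N.P x (T.S x v)) at this
    rwa [N.P_S] at this
  · obtain ⟨u, hu⟩ := N.exists_P_eq_S x v
    change diff n f x (N.P x v) = diff n h x (N.P x v)
    rw [hu]
    exact DFunLike.congr_fun heq u

/-- The cohomology class represented by a form of type `(0,1)` does not depend on the choice of
the local `d''`-primitives. -/
theorem classOf_eq_of_dpp_eq {k : OneForm n M} (hU : ∀ x, ∃ i, x ∈ U i)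
    (hV : ∀ x, ∃ j, x ∈ V j) {f : ι → M → ℝ} {h : κ → M → ℝ}
    (hf : ∀ i, SmoothFun n (f i) (U i)) (hh : ∀ j, SmoothFun n (h j) (V j))
    (hkf : ∀ i, ∀ x ∈ U i, k x = N.dpp (f i) x) (hkh : ∀ j, ∀ x ∈ V j, k x = N.dpp (h j) x)
    (c : T.foliatedFunctions.cocycles U) (d : T.foliatedFunctions.cocycles V)
    (hc : ∀ i j, ∀ x ∈ U i ⊓ U j, c.1 i j x = f j x - f i x)
    (hd : ∀ i j, ∀ x ∈ V i ⊓ V j, d.1 i j x = h j x - h i x) :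
    T.foliatedFunctions.classOf U hU c = T.foliatedFunctions.classOf V hV d := by
  refine T.foliatedFunctions.classOf_eq_classOf hU hV c d (fun i j => f i - h j)
    (fun i j => LocalLagrangians.foliatedFun_sub ((hf i).mono inf_le_left)
      ((hh j).mono inf_le_right) fun x hx => ?_) fun i i' j j' x hi hi' hj hj' => ?_
  · exact N.dpp_eq_dpp_iff.1 ((hkf i x hx.1).symm.trans (hkh j x hx.2))
  · rw [hc i i' x ⟨hi, hi'⟩, hd j j' x ⟨hj, hj'⟩]
    simp only [Pi.sub_apply]
    ring

theorem isType01_of_eq_dpp {k : OneForm n M} (hU : ∀ x, ∃ i, x ∈ U i) {f : ι → M → ℝ}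
    (hf : ∀ i, SmoothFun n (f i) (U i)) (hk : ∀ i, ∀ x ∈ U i, k x = N.dpp (f i) x) :
    N.IsType01 k := by
  refine ⟨fun x _ => ?_, fun x v hv => ?_⟩ <;> obtain ⟨i, hi⟩ := hU x
  · have hs : SmoothForm (N.dpp (f i)) (U i : Set M) :=
      smoothForm_comp (diff_smoothOn (hf i)) N.smooth
    have hs' : SmoothForm k (U i : Set M) :=
      ContMDiffOn.congr hs fun y hy => congrArg _ (hk i y hy)
    exact (ContMDiffOn.contMDiffAt hs' ((U i).isOpen.mem_nhds hi)).contMDiffWithinAt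
  · rw [hk i x hi]
    change diff n (f i) x (N.P x v) = 0
    rw [hv, map_zero]

/-- On the vertical coordinate vector fields of an adapted chart, which commute, a form which is
locally `d''f` has the same values as `df`. -/
theorem isDppClosed_of_eq_dpp {k : OneForm n M} (hU : ∀ x, ∃ i, x ∈ U i) {f : ι → M → ℝ}
    (hf : ∀ i, SmoothFun n (f i) (U i)) (hk : ∀ i, ∀ x ∈ U i, k x = N.dpp (f i) x) :
    N.IsDppClosed k := by
  intro x v w
  obtain ⟨i, hi⟩ := hU x
  obtain ⟨φ, hφ, hx⟩ := T.integrable x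
  let W : Opens M := U i ⊓ ⟨φ.source, φ.open_source⟩
  have hxW : x ∈ W := ⟨hi, hx⟩
  have hcoord : ∀ v, ∃ b : Fin n → ℝ, N.P x v = coordField φ (0, b) x := fun v => by
    obtain ⟨u, hu⟩ := N.exists_P_eq_S x v
    exact ⟨(dchart φ x u).1, by rw [hu, ← S_coordField hφ hx, coordField_dchart hφ.1 hx]⟩
  obtain ⟨a, ha⟩ := hcoord v
  obtain ⟨b, hb⟩ := hcoord w
  have hvert : ∀ b : Fin n → ℝ, diff n (fun z => k z (coordField φ (0, b) z)) x =
      diff n (fun z => diff n (f i) z (coordField φ (0, b) z)) x := fun b =>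
    diff_congr (U := W) (fun z hz => by
      rw [hk i z hz.1, coordField_vertical hφ hz.2]
      change diff n (f i) z (N.P z _) = _
      rw [N.P_S]) hxW
  rw [ha, hb, extD_coordField hφ.1 (W := ⊤) (N.isType01_of_eq_dpp hU hf hk).1 hx trivial,
    hvert, hvert, diff_diff_coordField_comm hφ.1 (hf i) hx hi, sub_self]

end NormalBundle

namespace LocalLagrangians

/-- The cocycle `L j - L i` with values in `Φ` of local Lagrangians with equal forms `θ`. -/
def foliatedCocycle (𝓛 : LocalLagrangians T g U) {θ : OneForm n M} (hθ : 𝓛.ThetaGlueTo θ) :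
    T.foliatedFunctions.cocycles U :=
  ⟨fun i j => 𝓛.L j - 𝓛.L i, fun i j => foliatedFun_sub ((𝓛.smooth j).mono inf_le_right)
    ((𝓛.smooth i).mono inf_le_left) fun x hx => by rw [← hθ.2 j x hx.2, ← hθ.2 i x hx.1],
    fun i j k x _ => by simp only [Pi.sub_apply]; ring⟩

theorem Subordinated.isSecondObstruction {𝓛 : LocalLagrangians T g U}
    {𝓛' : LocalLagrangians T g V} {r : κ → ι} (h : 𝓛'.Subordinated 𝓛 r) {θ : OneForm n M}
    (hθ : 𝓛'.ThetaGlueTo θ) :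
    𝓛.IsSecondObstruction (T.foliatedFunctions.classOf V 𝓛'.cover (𝓛'.foliatedCocycle hθ)) := by
  unfold IsSecondObstruction totalObstruction
  rw [SectionSheaf.Hom.mapH1_classOf]
  refine T.leafwiseAffineFunctions.classOf_eq_classOf _ _ _ _ (fun j i => 𝓛'.L j - 𝓛.L i)
    (fun j i => h.leafwiseAffine_sub j i) fun j j' i i' x _ _ _ _ => ?_
  change (𝓛'.L j' x - 𝓛'.L j x) - (𝓛.L i' x - 𝓛.L i x) =
    (𝓛'.L j' x - 𝓛.L i' x) - (𝓛'.L j x - 𝓛.L i x)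
  ring

end LocalLagrangians

end

end LagrangeGeometry

end

theorem proposition2p5 {n : ℕ} {M : Type u} [TopologicalSpace M] [T2Space M]
    [SecondCountableTopology M] [ChartedSpace (Model n) M] [IsManifold 𝓘(ℝ, Model n) ∞ M]
    (T : TangentStructure n M) (g : TransversalMetric T)
    {ι : Type v} (U : ι → Opens M) (𝓛 : LocalLagrangians T g U) :
    -- `𝒢₁ = 0` iff the `1`-forms of some subordinated structure glue up
    (𝓛.firstObstruction = 0 ↔
      ∃ (κ : Type u) (V : κ → Opens M) (r : κ → ι) (𝓛' : LocalLagrangians T g V),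
        𝓛'.Subordinated 𝓛 r ∧ ∃ θ, 𝓛'.ThetaGlueTo θ) ∧
    -- if the covering consists of coordinate neighborhoods, then no refinement is needed
    ((∀ i, ∃ φ, IsAdaptedChart T.S φ ∧ (U i : Set M) ⊆ φ.source) →
      (𝓛.firstObstruction = 0 ↔
        ∃ 𝓛' : LocalLagrangians T g U, 𝓛'.Subordinated 𝓛 id ∧ ∃ θ, 𝓛'.ThetaGlueTo θ)) ∧
    -- consequences, for every subordinated structure whose `1`-forms glue up
    ∀ (κ : Type w) (V : κ → Opens M) (r : κ → ι) (𝓛' : LocalLagrangians T g V),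
      𝓛'.Subordinated 𝓛 r → ∀ θ : OneForm n M, 𝓛'.ThetaGlueTo θ →
        (IsLocallyLagrangianSymplectic T (extD θ.toKForm) ∧
          ∀ j, ∀ x ∈ V j, extD θ.toKForm x = T.omega (𝓛'.L j) x) ∧
        ∀ N : NormalBundle T, ∃ k : OneForm n M,
          N.IsType01 k ∧ N.IsDppClosed k ∧ (∀ j, ∀ x ∈ V j, k x = N.dpp (𝓛'.L j) x) ∧
          ∃ c : T.foliatedFunctions.H1,
            (∀ c', N.Represents k c' ↔ c' = c) ∧ 𝓛.IsSecondObstruction c := by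
  refine ⟨⟨fun h0 => ?_, ?_⟩, fun hφ => ⟨fun h0 => ?_, ?_⟩, ?_⟩
  · choose i hi using 𝓛.cover
    choose φ hφ hx using T.integrable
    exact ⟨M, fun x => U (i x) ⊓ ⟨(φ x).source, (φ x).open_source⟩, i,
      LocalLagrangians.exists_thetaGlueTo_of_firstObstruction_eq_zero h0 i
        (fun x => inf_le_left) (fun x => ⟨x, hi x, hx x⟩)
        fun x => ⟨φ x, hφ x, inter_subset_right⟩⟩
  · rintro ⟨κ, V, r, 𝓛', hsub, θ, hθ⟩
    exact LocalLagrangians.firstObstruction_eq_zero_of_thetaGlueTo hsub hθ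
  · exact LocalLagrangians.exists_thetaGlueTo_of_firstObstruction_eq_zero h0 id
      (fun i => le_rfl) 𝓛.cover hφ
  · rintro ⟨𝓛', hsub, θ, hθ⟩
    exact LocalLagrangians.firstObstruction_eq_zero_of_thetaGlueTo hsub hθ
  · intro κ V r 𝓛' hsub θ hθ
    refine ⟨⟨LocalLagrangians.isLocallyLagrangianSymplectic_extD hθ,
      fun j x hx => extD_congr (hθ.2 j) hx⟩, fun N => ?_⟩
    choose j hj using 𝓛'.cover
    let k : OneForm n M := fun x => N.dpp (𝓛'.L (j x)) x
    have hk : ∀ i, ∀ x ∈ V i, k x = N.dpp (𝓛'.L i) x := fun i x hx =>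
      N.dpp_eq_dpp_iff.2 (by rw [← hθ.2 i x hx, ← hθ.2 (j x) x (hj x)])
    refine ⟨k, N.isType01_of_eq_dpp 𝓛'.cover 𝓛'.smooth hk,
      N.isDppClosed_of_eq_dpp 𝓛'.cover 𝓛'.smooth hk, hk,
      T.foliatedFunctions.classOf V 𝓛'.cover (𝓛'.foliatedCocycle hθ), fun c' => ⟨?_, ?_⟩,
      hsub.isSecondObstruction hθ⟩
    · rintro ⟨ι', U', hU', f, z, hf, hkf, hz, rfl⟩
      exact N.classOf_eq_of_dpp_eq hU' 𝓛'.cover hf 𝓛'.smooth hkf hk z _ hz fun _ _ _ _ => rfl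
    · rintro rfl
      -- the covering is reindexed by the points of `M`, since the universe of `κ` is arbitrary
      let z := 𝓛'.foliatedCocycle hθ
      have hcover : ∀ x, ∃ y, x ∈ V (j y) := fun x => ⟨x, hj x⟩
      exact ⟨M, fun x => V (j x), hcover, fun x => 𝓛'.L (j x),
        ⟨fun x y => z.1 (j x) (j y), fun x y => z.2.1 _ _, fun x y t => z.2.2 _ _ _⟩,
        fun x => 𝓛'.smooth (j x), fun x => hk (j x), fun _ _ _ _ => rfl,
        N.classOf_eq_of_dpp_eq 𝓛'.cover hcover 𝓛'.smooth (fun x => 𝓛'.smooth (j x)) hk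
          (fun x => hk (j x)) z _ (fun _ _ _ _ => rfl) fun _ _ _ _ => rfl⟩
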